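/- Let $N\ge 2$, and let $x$, $\hat z$ and $\phi_1,\phi_2,\phi_3,\dots$ be mutually independent random vectors in $\mathbb{R}^N$, each uniformly distributed on the unit sphere. Starting from $\hat x_1=\hat z$, define the running estimates of $x$ recursively as follows, using only the frame vectors and the signs $\nu_{k,j}=\operatorname{sign}\langle x,\phi_k-\phi_j\rangle$. For each $k\ge 2$ let $\mathcal J_k\subset\{1,\dots,k-1\}$ be a given index set. To obtain $\hat x_k$, start from $\hat x_{k-1}$ and, for each $j\in\mathcal J_k$ taken in some (random) order, put $\psi_{k,j}=\phi_k-\phi_j$ and, if the current estimate $z$ satisfies $\operatorname{sign}\langle z,\psi_{k,j}\rangle\neq\nu_{k,j}$, replace $z$ by $z-\frac{\langle z,\psi_{k,j}\rangle}{\|\psi_{k,j}\|^2}\psi_{k,j}$; the result after all $j\in\mathcal J_k$ is $\hat x_k$. If $\mathcal J_k=\{1\}$ for every $k\ge 2$, then the normalized estimates satisfy, for every real $p<2$, $$\Big\|x-\frac{\hat x_k}{\|\hat x_k\|}\Big\|^2\,k^p\;\longrightarrow\;0\quad\text{almost surely as }k\to\infty.$$ -/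

import Mathlib

open MeasureTheory ProbabilityTheory Filter Topology

noncomputable section

/-- The uniform probability distribution on the unit sphere of `ℝ^N`: the normalized surface
measure, regarded as a measure on the ambient Euclidean space. -/
def uniformSphere (N : ℕ) : Measure (EuclideanSpace ℝ (Fin N)) :=
  ((volume : Measure (EuclideanSpace ℝ (Fin N))).toSphere Set.univ)⁻¹ •
    ((volume : Measure (EuclideanSpace ℝ (Fin N))).toSphere).map Subtype.val

/-- The frame permutation quantization of `x` (Variant I, all-ones composition):
`ν i j = sign ⟨x, φ i - φ j⟩`. -/
def fpqRepresentation {N : ℕ} (x : EuclideanSpace ℝ (Fin N))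
    (φ : ℕ+ → EuclideanSpace ℝ (Fin N)) (i j : ℕ+) : SignType :=
  SignType.sign (inner ℝ x (φ i - φ j))

/-- One projection step: if `sign ⟨z, ψ⟩` differs from the recorded sign `s`, replace `z` by its
orthogonal projection onto the hyperplane `ψ^⊥`; otherwise keep `z`. -/
def projectionStep {N : ℕ} (s : SignType) (ψ z : EuclideanSpace ℝ (Fin N)) :
    EuclideanSpace ℝ (Fin N) :=
  if SignType.sign (inner ℝ z ψ) ≠ s then z - (inner ℝ z ψ / ‖ψ‖ ^ 2) • ψ else z

/-- The list `l` runs through the elements of the finite set `s` in some order, each once. -/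
def IsOrdering (s : Finset ℕ+) (l : List ℕ+) : Prop :=
  l.Nodup ∧ l.toFinset = s

/-- The running estimates of the recursive algorithm. Inputs: the frame sequence `φ`, the recorded
signs `ν`, for each `k` the list `ord k` of the indices `j` in the index set of `k` in the order in
which they are processed, and the initial estimate `z₁`. The first estimate is `z₁`; the estimate
at `k + 1` is obtained from the one at `k` by performing, successively for the `j` in
`ord (k + 1)`, the projection step with `φ (k + 1) - φ j` and the sign `ν (k + 1) j`. -/
def runningEstimate {N : ℕ} (φ : ℕ+ → EuclideanSpace ℝ (Fin N)) (ν : ℕ+ → ℕ+ → SignType)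
    (ord : ℕ+ → List ℕ+) (z₁ : EuclideanSpace ℝ (Fin N)) (k : ℕ+) :
    EuclideanSpace ℝ (Fin N) :=
  PNat.recOn k z₁ fun k z =>
    (ord (k + 1)).foldl (fun z j => projectionStep (ν (k + 1) j) (φ (k + 1) - φ j) z) z

/-- The estimate returned by the algorithm run on `k` frame vectors: the running estimate at `k`
divided by its norm. -/
def normalizedEstimate {N : ℕ} (φ : ℕ+ → EuclideanSpace ℝ (Fin N)) (ν : ℕ+ → ℕ+ → SignType)
    (ord : ℕ+ → List ℕ+) (z₁ : EuclideanSpace ℝ (Fin N)) (k : ℕ+) :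
    EuclideanSpace ℝ (Fin N) :=
  ‖runningEstimate φ ν ord z₁ k‖⁻¹ • runningEstimate φ ν ord z₁ k

end

/-! Only the reference `p = φ 1` is ever compared, so the estimate is a Markov chain driven by
independent uniform vectors. A step never increases `‖z‖` and never decreases `⟨z, x⟩`. Hence, once
`⟨z, x⟩ ≥ 0`, the squared distance `D` from `z` to the line `ℝx` is nonincreasing, and once `⟨z, x⟩
> 0` it controls the normalized error up to a constant (`sq_norm_sub_normalize_le`).

Rate: a window of new vectors of probability of order `√D` separates `x` from `z` and removes a
fixed fraction of `D`, so the conditional mean of `D` falls by at least `γ D^(3/2)`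
(`exists_integral_sqDistLine_signStep_le`). Convexity turns this into a recursion for the integral
of `D` over a past event, which is therefore `O(n⁻²)` (`mul_sq_le_of_le_sub_mul_sqrt`). For `q < 2`
the integrals at dyadic times, multiplied by `2^(jq)`, are summable, so `2^(jq) D` is almost surely
bounded there (`ae_bounded_dyadic`), and monotonicity fills the gaps.

Two obstacles remain. The chain may start with `⟨z, x⟩ ≤ 0`: two steps leave that half-space with
probability bounded below, by compactness (`exists_le_prod_two_steps_pos`, `ae_exists_inner_pos`).
And `γ` degenerates as `p` approaches `±x`: this is handled by countably many lower bounds `r = 1 /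
(i + 1)`, since `p ≠ ±x` almost surely. -/

/-- One step of the recursion with target `x`, reference vector `p`, current estimate `z` and new
frame vector `y`. -/
noncomputable def signStep {N : ℕ} (x p z y : EuclideanSpace ℝ (Fin N)) : EuclideanSpace ℝ (Fin N) :=
  projectionStep (SignType.sign (inner ℝ x (y - p))) (y - p) z

/-- The squared distance from `z` to the line spanned by the unit vector `x`. -/
noncomputable def sqDistLine {N : ℕ} (x z : EuclideanSpace ℝ (Fin N)) : ℝ :=
  ‖z‖ ^ 2 - (inner ℝ z x : ℝ) ^ 2

/-! ### Deterministic geometry of one projection step -/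

section Geometry

variable {N : ℕ} {x p z y : EuclideanSpace ℝ (Fin N)}

lemma mul_nonpos_of_sign_ne {a b : ℝ} (h : SignType.sign a ≠ SignType.sign b) : a * b ≤ 0 := by
  by_contra! hab
  rcases pos_and_pos_or_neg_and_neg_of_mul_pos hab with ⟨ha, hb⟩ | ⟨ha, hb⟩
  · exact h (by rw [sign_pos ha, sign_pos hb])
  · exact h (by rw [sign_neg ha, sign_neg hb])

lemma sign_ne_of_mul_neg {a b : ℝ} (h : a * b < 0) : SignType.sign a ≠ SignType.sign b := by
  rcases mul_neg_iff.1 h with ⟨ha, hb⟩ | ⟨ha, hb⟩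
  · rw [sign_pos ha, sign_neg hb]; decide
  · rw [sign_neg ha, sign_pos hb]; decide

lemma signStep_of_ne (h : SignType.sign (inner ℝ z (y - p) : ℝ) ≠
    SignType.sign (inner ℝ x (y - p) : ℝ)) :
    signStep x p z y = z - ((inner ℝ z (y - p) : ℝ) / ‖y - p‖ ^ 2) • (y - p) := by
  rw [signStep, projectionStep, if_pos h]

lemma signStep_of_eq (h : SignType.sign (inner ℝ z (y - p) : ℝ) =
    SignType.sign (inner ℝ x (y - p) : ℝ)) : signStep x p z y = z := by
  rw [signStep, projectionStep, if_neg (by simpa using h)]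

lemma signStep_of_mul_neg (h : (inner ℝ z (y - p) : ℝ) * inner ℝ x (y - p) < 0) :
    signStep x p z y = z - ((inner ℝ z (y - p) : ℝ) / ‖y - p‖ ^ 2) • (y - p) :=
  signStep_of_ne (sign_ne_of_mul_neg h)

lemma inner_sub_smul_div_sq (x z ψ : EuclideanSpace ℝ (Fin N)) :
    (inner ℝ (z - ((inner ℝ z ψ : ℝ) / ‖ψ‖ ^ 2) • ψ) x : ℝ) =
      inner ℝ z x - inner ℝ z ψ * inner ℝ x ψ / ‖ψ‖ ^ 2 := by
  rw [inner_sub_left, real_inner_smul_left, real_inner_comm x ψ]; ring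

lemma norm_sq_sub_smul_div_sq (z ψ : EuclideanSpace ℝ (Fin N)) :
    ‖z - ((inner ℝ z ψ : ℝ) / ‖ψ‖ ^ 2) • ψ‖ ^ 2 = ‖z‖ ^ 2 - (inner ℝ z ψ : ℝ) ^ 2 / ‖ψ‖ ^ 2 := by
  rw [norm_sub_sq_real, real_inner_smul_right, norm_smul, mul_pow, Real.norm_eq_abs, sq_abs]
  rcases eq_or_ne ψ 0 with rfl | h
  · simp
  · have : ‖ψ‖ ≠ 0 := norm_ne_zero_iff.2 h
    field_simp
    ring

/-- When a projection takes place, `⟨z, ψ⟩⟨x, ψ⟩ ≤ 0`, and a positive multiple of this product is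
what gets subtracted (or `0` when `ψ = 0`). -/
lemma inner_le_inner_signStep (x p z y : EuclideanSpace ℝ (Fin N)) :
    (inner ℝ z x : ℝ) ≤ inner ℝ (signStep x p z y) x := by
  by_cases h : SignType.sign (inner ℝ z (y - p) : ℝ) = SignType.sign (inner ℝ x (y - p) : ℝ)
  · rw [signStep_of_eq h]
  · rw [signStep_of_ne h, inner_sub_smul_div_sq]
    have := div_nonpos_of_nonpos_of_nonneg (mul_nonpos_of_sign_ne h) (sq_nonneg ‖y - p‖)
    linarith

lemma norm_signStep_le (x p z y : EuclideanSpace ℝ (Fin N)) :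
    ‖signStep x p z y‖ ≤ ‖z‖ := by
  by_cases h : SignType.sign (inner ℝ z (y - p) : ℝ) = SignType.sign (inner ℝ x (y - p) : ℝ)
  · rw [signStep_of_eq h]
  · rw [signStep_of_ne h]
    refine le_of_sq_le_sq ?_ (norm_nonneg _)
    rw [norm_sq_sub_smul_div_sq]
    have : 0 ≤ (inner ℝ z (y - p) : ℝ) ^ 2 / ‖y - p‖ ^ 2 := by positivity
    linarith

lemma sqDistLine_nonneg (hx : ‖x‖ = 1) : 0 ≤ sqDistLine x z := by
  have h := abs_real_inner_le_norm z x
  rw [hx, mul_one] at h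
  have := sq_le_sq' (by linarith [abs_le.1 h, norm_nonneg z]) (abs_le.1 h).2
  rw [sqDistLine]; linarith

lemma sqDistLine_le : sqDistLine x z ≤ ‖z‖ ^ 2 := by
  rw [sqDistLine]; nlinarith [sq_nonneg (inner ℝ z x : ℝ)]

/-- The norm falls and the inner product grows; nonnegativity is what lets the second inequality be
squared. -/
lemma sqDistLine_signStep_le (h : 0 ≤ (inner ℝ z x : ℝ)) :
    sqDistLine x (signStep x p z y) ≤ sqDistLine x z := by
  have h1 := inner_le_inner_signStep x p z y
  have h2 := norm_signStep_le x p z y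
  have h3 : ‖signStep x p z y‖ ^ 2 ≤ ‖z‖ ^ 2 := by gcongr
  have h4 : (inner ℝ z x : ℝ) ^ 2 ≤ (inner ℝ (signStep x p z y) x : ℝ) ^ 2 := by gcongr
  rw [sqDistLine, sqDistLine]; linarith

lemma sqDistLine_signStep_le_sub (h : 0 ≤ (inner ℝ z x : ℝ))
    (hs : (inner ℝ z (y - p) : ℝ) * inner ℝ x (y - p) < 0) :
    sqDistLine x (signStep x p z y) ≤
      sqDistLine x z - (inner ℝ z (y - p) : ℝ) ^ 2 / ‖y - p‖ ^ 2 := by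
  have h1 := inner_le_inner_signStep x p z y
  have h4 : (inner ℝ z x : ℝ) ^ 2 ≤ (inner ℝ (signStep x p z y) x : ℝ) ^ 2 := by gcongr
  rw [sqDistLine, sqDistLine]
  have h3 : ‖signStep x p z y‖ ^ 2 = ‖z‖ ^ 2 - (inner ℝ z (y - p) : ℝ) ^ 2 / ‖y - p‖ ^ 2 := by
    rw [signStep_of_mul_neg hs, norm_sq_sub_smul_div_sq]
  linarith

/-- The only unit vector `y` for which the step can send a nonzero `z` to zero is the reflection
of `p` in `zᗮ`. -/
lemma eq_of_signStep_eq_zero (hp : ‖p‖ = 1) (hy : ‖y‖ = 1) (hz : z ≠ 0)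
    (h : signStep x p z y = 0) : y = p - (2 * (inner ℝ z p : ℝ) / ‖z‖ ^ 2) • z := by
  by_cases hs : SignType.sign (inner ℝ z (y - p) : ℝ) = SignType.sign (inner ℝ x (y - p) : ℝ)
  · exact absurd (signStep_of_eq hs ▸ h) hz
  rw [signStep_of_ne hs, sub_eq_zero] at h
  set t := (inner ℝ z (y - p) : ℝ) / ‖y - p‖ ^ 2
  have ht : t ≠ 0 := by
    rintro ht
    rw [ht, zero_smul] at h
    exact hz h
  -- So `y` is on the line through `p` in direction `z`, which meets the unit sphere only at `p`,
  -- excluded by `t⁻¹ ≠ 0`, and at its reflection.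
  have hyp : y = p + t⁻¹ • z := by
    rw [h, smul_smul, inv_mul_cancel₀ ht, one_smul]; abel
  have hn : ‖z‖ ≠ 0 := norm_ne_zero_iff.2 hz
  have key : ‖y‖ ^ 2 = ‖p‖ ^ 2 + 2 * (t⁻¹ * inner ℝ z p) + t⁻¹ ^ 2 * ‖z‖ ^ 2 := by
    rw [hyp, norm_add_sq_real, real_inner_smul_right, norm_smul, mul_pow, Real.norm_eq_abs, sq_abs,
      real_inner_comm]
  rw [hp, hy] at key
  have h2 : t⁻¹ * (2 * inner ℝ z p + t⁻¹ * ‖z‖ ^ 2) = 0 := by linarith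
  have h3 : 2 * (inner ℝ z p : ℝ) + t⁻¹ * ‖z‖ ^ 2 = 0 := by
    rcases mul_eq_zero.1 h2 with h | h
    · exact absurd h (inv_ne_zero ht)
    · exact h
  have h4 : t⁻¹ = -(2 * (inner ℝ z p : ℝ) / ‖z‖ ^ 2) := by
    field_simp
    field_simp at h3
    linarith
  rw [hyp, h4, neg_smul, ← sub_eq_add_neg]

/-- With `c = ⟨z, x⟩ / ‖z‖` in `(0, 1]` the left side is `2(1 - c) ≤ 2(1 - c²) = 2D / ‖z‖²`, and
`⟨z, x⟩ ≤ ‖z‖`. -/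
lemma sq_norm_sub_normalize_le (hx : ‖x‖ = 1) (hz : 0 < (inner ℝ z x : ℝ)) :
    ‖x - ‖z‖⁻¹ • z‖ ^ 2 ≤ 2 * sqDistLine x z / (inner ℝ z x : ℝ) ^ 2 := by
  have hz0 : z ≠ 0 := by rintro rfl; simp at hz
  have hn : 0 < ‖z‖ := norm_pos_iff.2 hz0
  have hle : (inner ℝ z x : ℝ) ≤ ‖z‖ := by
    simpa [hx] using real_inner_le_norm z x
  have h1 : ‖x - ‖z‖⁻¹ • z‖ ^ 2 = 2 - 2 * ((inner ℝ z x : ℝ) / ‖z‖) := by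
    rw [norm_sub_sq_real, real_inner_smul_right, norm_smul, norm_inv, norm_norm,
      inv_mul_cancel₀ hn.ne', hx, real_inner_comm]
    ring
  have h2 : sqDistLine x z / ‖z‖ ^ 2 = 1 - ((inner ℝ z x : ℝ) / ‖z‖) ^ 2 := by
    rw [sqDistLine]; field_simp
  set a := (inner ℝ z x : ℝ)
  have h3 : a / ‖z‖ ≤ 1 := (div_le_one hn).2 hle
  have h4 : 0 < a / ‖z‖ := by positivity
  have h5 : sqDistLine x z / ‖z‖ ^ 2 ≤ sqDistLine x z / a ^ 2 := by
    have := sqDistLine_nonneg (z := z) hx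
    gcongr
  rw [h1, mul_div_assoc]
  nlinarith

/-- Strict disagreement of signs is an open condition, and where it holds the step is the projection
formula with `ψ ≠ 0`. -/
lemma continuousAt_signStep (s : EuclideanSpace ℝ (Fin N) × EuclideanSpace ℝ (Fin N) ×
      EuclideanSpace ℝ (Fin N) × EuclideanSpace ℝ (Fin N))
    (hs : (inner ℝ s.2.2.1 (s.2.2.2 - s.2.1) : ℝ) * inner ℝ s.1 (s.2.2.2 - s.2.1) < 0) :
    ContinuousAt (fun s : EuclideanSpace ℝ (Fin N) × EuclideanSpace ℝ (Fin N) ×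
      EuclideanSpace ℝ (Fin N) × EuclideanSpace ℝ (Fin N) =>
        signStep s.1 s.2.1 s.2.2.1 s.2.2.2) s := by
  have hψ : s.2.2.2 - s.2.1 ≠ 0 := by
    intro h; simp [h] at hs
  have hc : ContinuousAt (fun s : EuclideanSpace ℝ (Fin N) × EuclideanSpace ℝ (Fin N) ×
      EuclideanSpace ℝ (Fin N) × EuclideanSpace ℝ (Fin N) =>
      s.2.2.1 - ((inner ℝ s.2.2.1 (s.2.2.2 - s.2.1) : ℝ) / ‖s.2.2.2 - s.2.1‖ ^ 2) •
        (s.2.2.2 - s.2.1)) s := by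
    have : ‖s.2.2.2 - s.2.1‖ ^ 2 ≠ 0 := by simpa using hψ
    fun_prop (disch := exact this)
  refine hc.congr ?_
  have ho : ∀ᶠ s' in 𝓝 s, (inner ℝ s'.2.2.1 (s'.2.2.2 - s'.2.1) : ℝ) *
      inner ℝ s'.1 (s'.2.2.2 - s'.2.1) < 0 := by
    have : Continuous fun s' : EuclideanSpace ℝ (Fin N) × EuclideanSpace ℝ (Fin N) ×
      EuclideanSpace ℝ (Fin N) × EuclideanSpace ℝ (Fin N) =>
        (inner ℝ s'.2.2.1 (s'.2.2.2 - s'.2.1) : ℝ) * inner ℝ s'.1 (s'.2.2.2 - s'.2.1) := by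
      fun_prop
    exact this.continuousAt.eventually_lt continuousAt_const hs
  filter_upwards [ho] with s' hs'
  exact (signStep_of_mul_neg hs').symm

/-- Every nonempty open set contains the direction of a chord of the unit sphere at `p`. -/
lemma exists_chord_mem {U : Set (EuclideanSpace ℝ (Fin N))} (hU : IsOpen U) (hne : U.Nonempty)
    (hp : ‖p‖ = 1) : ∃ u ∈ U, ∃ t : ℝ, t ≠ 0 ∧ ‖p + t • u‖ = 1 := by
  obtain ⟨u, hu, hup⟩ : ∃ u ∈ U, (inner ℝ p u : ℝ) ≠ 0 := by
    obtain ⟨u₀, hu₀⟩ := hne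
    by_cases h : (inner ℝ p u₀ : ℝ) = 0
    -- Directions orthogonal to `p` are tangent and give no chord; a small tilt towards `p` repairs
    -- this inside `U`.
    · have hc : Tendsto (fun ε : ℝ => u₀ + ε • p) (𝓝[≠] 0) (𝓝 u₀) := by
        have : Continuous fun ε : ℝ => u₀ + ε • p := by fun_prop
        simpa using (this.tendsto 0).mono_left nhdsWithin_le_nhds
      obtain ⟨ε, hε, hε0⟩ := ((hc.eventually (hU.mem_nhds hu₀)).and self_mem_nhdsWithin).exists
      refine ⟨_, hε, ?_⟩
      rw [inner_add_right, h, real_inner_smul_right, real_inner_self_eq_norm_sq, hp]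
      simpa using hε0
    · exact ⟨u₀, hu₀, h⟩
  have hu0 : u ≠ 0 := by rintro rfl; simp at hup
  have hn : ‖u‖ ≠ 0 := norm_ne_zero_iff.2 hu0
  refine ⟨u, hu, -(2 * inner ℝ p u / ‖u‖ ^ 2), ?_, ?_⟩
  · simp [hup, hn]
  · have : ‖p + (-(2 * (inner ℝ p u : ℝ) / ‖u‖ ^ 2)) • u‖ ^ 2 = 1 ^ 2 := by
      rw [norm_add_sq_real, real_inner_smul_right, norm_smul, mul_pow, Real.norm_eq_abs, sq_abs, hp]
      field_simp
      ring
    exact (sq_eq_sq₀ (norm_nonneg _) zero_le_one).1 this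

/-- Projection along `ψ` makes `⟨z, x⟩` positive when `⟨z, ψ⟩⟨x, ψ⟩ < ⟨z, x⟩‖ψ‖²`. This is open and
invariant under scaling of `ψ`, so one solution `ψ` suffices: a nearby one is the direction of a
chord at `p`. -/
lemma exists_inner_mul_inner_lt (hx : ‖x‖ = 1) (hp : ‖p‖ = 1) (hz : (inner ℝ z x : ℝ) ≤ 0)
    (hz' : -‖z‖ < (inner ℝ z x : ℝ)) :
    ∃ y : EuclideanSpace ℝ (Fin N), ‖y‖ = 1 ∧
      (inner ℝ z (y - p) : ℝ) * inner ℝ x (y - p) < 0 ∧ 0 < (inner ℝ (signStep x p z y) x : ℝ) := by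
  set U : Set (EuclideanSpace ℝ (Fin N)) :=
    {u | (inner ℝ z u : ℝ) * inner ℝ x u < inner ℝ z x * ‖u‖ ^ 2} with hU
  have hUo : IsOpen U := isOpen_lt (by fun_prop) (by fun_prop)
  have hUn : U.Nonempty := by
    -- With `n = ‖z‖` and `c = ⟨z, x⟩`, the two sides differ by `n(n - c)(n + c)`, positive as `z`
    -- is not antiparallel to `x`.
    refine ⟨z - ‖z‖ • x, ?_⟩
    rw [hU, Set.mem_ofPred_eq]
    have e1 : (inner ℝ z (z - ‖z‖ • x) : ℝ) = ‖z‖ ^ 2 - ‖z‖ * inner ℝ z x := by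
      rw [inner_sub_right, real_inner_smul_right, real_inner_self_eq_norm_sq]
    have e2 : (inner ℝ x (z - ‖z‖ • x) : ℝ) = inner ℝ z x - ‖z‖ := by
      rw [inner_sub_right, real_inner_smul_right, real_inner_self_eq_norm_sq, hx,
        real_inner_comm]; ring
    have e3 : ‖z - ‖z‖ • x‖ ^ 2 = 2 * ‖z‖ ^ 2 - 2 * ‖z‖ * inner ℝ z x := by
      rw [norm_sub_sq_real, real_inner_smul_right, norm_smul, norm_norm, hx]; ring
    rw [e1, e2, e3]
    set n := ‖z‖
    set c := (inner ℝ z x : ℝ)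
    have hn : 0 < n := by linarith
    have : 0 < n * (n - c) * (n + c) := by
      have h1 : 0 < n - c := by linarith
      have h2 : 0 < n + c := by linarith
      positivity
    nlinarith
  obtain ⟨u, hu, t, ht, hut⟩ := exists_chord_mem hUo hUn hp
  rw [hU, Set.mem_ofPred_eq] at hu
  have hu0 : u ≠ 0 := by rintro rfl; simp at hu
  have key : (inner ℝ z (t • u) : ℝ) * inner ℝ x (t • u) < inner ℝ z x * ‖t • u‖ ^ 2 := by
    rw [real_inner_smul_right, real_inner_smul_right, norm_smul, mul_pow, Real.norm_eq_abs, sq_abs]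
    have : 0 < t ^ 2 := by positivity
    nlinarith
  have hneg : (inner ℝ z (t • u) : ℝ) * inner ℝ x (t • u) < 0 := by
    have : 0 ≤ ‖t • u‖ ^ 2 := by positivity
    nlinarith
  have hsub : p + t • u - p = t • u := by abel
  refine ⟨p + t • u, hut, by rwa [hsub], ?_⟩
  rw [signStep_of_mul_neg (by rwa [hsub]), hsub, inner_sub_smul_div_sq]
  have hpos : 0 < ‖t • u‖ ^ 2 := by
    have : t • u ≠ 0 := smul_ne_zero ht hu0
    positivity
  rw [sub_pos, div_lt_iff₀ hpos]
  exact key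

/-- For antiparallel `z` one projection only gives `⟨z, x⟩ = -‖z‖(1 - q)`, where `q` is the squared
cosine of the angle between `x` and `ψ`. The norm becomes `‖z‖√(1 - q)`, so any `0 < q < 1` destroys
antiparallelism and prepares a second step. -/
lemma exists_signStep_not_antiparallel (hN : 2 ≤ N) (hx : ‖x‖ = 1) (hp : ‖p‖ = 1) (hz : z ≠ 0)
    (hzx : z = -(‖z‖ • x)) :
    ∃ y : EuclideanSpace ℝ (Fin N), ‖y‖ = 1 ∧
      (inner ℝ z (y - p) : ℝ) * inner ℝ x (y - p) < 0 ∧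
      (inner ℝ (signStep x p z y) x : ℝ) ≤ 0 ∧
      -‖signStep x p z y‖ < (inner ℝ (signStep x p z y) x : ℝ) := by
  set U : Set (EuclideanSpace ℝ (Fin N)) :=
    {u | 0 < (inner ℝ x u : ℝ) ^ 2} ∩ {u | (inner ℝ x u : ℝ) ^ 2 < ‖u‖ ^ 2} with hU
  have hUo : IsOpen U :=
    (isOpen_lt (by fun_prop) (by fun_prop)).inter (isOpen_lt (by fun_prop) (by fun_prop))
  have hUn : U.Nonempty := by
    obtain ⟨v, hv, hvx⟩ : ∃ v : EuclideanSpace ℝ (Fin N), v ≠ 0 ∧ (inner ℝ x v : ℝ) = 0 := by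
      by_contra! hcon
      have hbot : (ℝ ∙ x)ᗮ = ⊥ := by
        rw [Submodule.eq_bot_iff]
        intro v hv
        by_contra hv0
        exact hcon v hv0 (Submodule.mem_orthogonal_singleton_iff_inner_right.1 hv)
      have h1 := Submodule.finrank_add_finrank_orthogonal (ℝ ∙ x)
      rw [hbot, finrank_bot, finrank_euclideanSpace_fin] at h1
      have h2 := finrank_span_le_card (R := ℝ) ({x} : Set (EuclideanSpace ℝ (Fin N)))
      simp at h2
      omega
    refine ⟨x + v, ?_, ?_⟩
    · rw [Set.mem_ofPred_eq, inner_add_right, hvx, real_inner_self_eq_norm_sq, hx]; norm_num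
    · rw [Set.mem_ofPred_eq, inner_add_right, hvx, real_inner_self_eq_norm_sq, norm_add_sq_real, hvx,
        hx]
      have : 0 < ‖v‖ ^ 2 := by positivity
      linarith
  obtain ⟨u, ⟨hu1, hu2⟩, t, ht, hut⟩ := exists_chord_mem hUo hUn hp
  rw [Set.mem_ofPred_eq] at hu1 hu2
  have hsub : p + t • u - p = t • u := by abel
  set ψ := t • u with hψ
  have ht2 : 0 < t ^ 2 := by positivity
  have h1 : 0 < (inner ℝ x ψ : ℝ) ^ 2 := by
    rw [hψ, real_inner_smul_right, mul_pow]; positivity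
  have h2 : (inner ℝ x ψ : ℝ) ^ 2 < ‖ψ‖ ^ 2 := by
    rw [hψ, real_inner_smul_right, mul_pow, norm_smul, mul_pow, Real.norm_eq_abs, sq_abs]
    exact mul_lt_mul_of_pos_left hu2 ht2
  have hψpos : 0 < ‖ψ‖ ^ 2 := h1.trans h2
  have hn : 0 < ‖z‖ := norm_pos_iff.2 hz
  have hzψ : (inner ℝ z ψ : ℝ) = -(‖z‖ * inner ℝ x ψ) := by
    conv_lhs => rw [hzx]
    rw [inner_neg_left, real_inner_smul_left]
  have hzxi : (inner ℝ z x : ℝ) = -‖z‖ := by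
    conv_lhs => rw [hzx]
    rw [inner_neg_left, real_inner_smul_left, real_inner_self_eq_norm_sq, hx]; ring
  have hneg : (inner ℝ z ψ : ℝ) * inner ℝ x ψ < 0 := by
    rw [hzψ]; nlinarith
  set q := (inner ℝ x ψ : ℝ) ^ 2 / ‖ψ‖ ^ 2 with hq
  have hq0 : 0 < q := by positivity
  have hq1 : q < 1 := (div_lt_one hψpos).2 h2
  have e1 : (inner ℝ (signStep x p z (p + ψ)) x : ℝ) = -(‖z‖ * (1 - q)) := by
    rw [signStep_of_mul_neg (by rwa [hsub]), hsub, inner_sub_smul_div_sq, hzxi, hzψ, hq]; ring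
  have e2 : ‖signStep x p z (p + ψ)‖ ^ 2 = ‖z‖ ^ 2 * (1 - q) := by
    rw [signStep_of_mul_neg (by rwa [hsub]), hsub, norm_sq_sub_smul_div_sq, hzψ, hq]; ring
  refine ⟨p + ψ, hut, by rwa [hsub], ?_, ?_⟩
  · rw [e1]; nlinarith
  · rw [e1, neg_lt_neg_iff]
    refine lt_of_pow_lt_pow_left₀ 2 (norm_nonneg _) ?_
    rw [e2, mul_pow]
    have : 0 < ‖z‖ ^ 2 := by positivity
    have : (1 - q) ^ 2 < 1 - q := by nlinarith
    gcongr

lemma eq_neg_smul_of_inner_le (hx : ‖x‖ = 1) (h : (inner ℝ z x : ℝ) ≤ -‖z‖) :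
    z = -(‖z‖ • x) := by
  have : ‖z + ‖z‖ • x‖ ^ 2 ≤ 0 := by
    rw [norm_add_sq_real, real_inner_smul_right, norm_smul, norm_norm, hx]
    nlinarith [norm_nonneg z]
  have h0 : ‖z + ‖z‖ • x‖ = 0 := by
    have := sq_nonneg ‖z + ‖z‖ • x‖
    exact pow_eq_zero_iff two_ne_zero |>.1 (le_antisymm ‹_› this)
  exact eq_neg_of_add_eq_zero_left (norm_eq_zero.1 h0)

/-- From every nonzero estimate in the wrong half-space, two suitable steps lead into the right
half-space, and this persists under small perturbations of all data. -/
lemma exists_two_steps_pos (hN : 2 ≤ N) (hx : ‖x‖ = 1) (hp : ‖p‖ = 1) (hz : z ≠ 0)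
    (hzx : (inner ℝ z x : ℝ) ≤ 0) :
    ∃ y y' : EuclideanSpace ℝ (Fin N), ‖y‖ = 1 ∧ ‖y'‖ = 1 ∧
      ∀ᶠ s in 𝓝 ((x, p, z), (y, y')),
        0 < (inner ℝ (signStep s.1.1 s.1.2.1 (signStep s.1.1 s.1.2.1 s.1.2.2 s.2.1) s.2.2)
          s.1.1 : ℝ) := by
  have hfst : ∀ y y' : EuclideanSpace ℝ (Fin N),
      (inner ℝ z (y - p) : ℝ) * inner ℝ x (y - p) < 0 →
      ContinuousAt (fun s : (EuclideanSpace ℝ (Fin N) × EuclideanSpace ℝ (Fin N) ×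
        EuclideanSpace ℝ (Fin N)) × EuclideanSpace ℝ (Fin N) × EuclideanSpace ℝ (Fin N) =>
        signStep s.1.1 s.1.2.1 s.1.2.2 s.2.1) ((x, p, z), (y, y')) := by
    intro y y' hy
    have h := continuousAt_signStep (x, p, z, y) hy
    exact ContinuousAt.comp' (x := ((x, p, z), (y, y'))) (f := fun s : (EuclideanSpace ℝ (Fin N) × EuclideanSpace ℝ (Fin N) ×
        EuclideanSpace ℝ (Fin N)) × EuclideanSpace ℝ (Fin N) × EuclideanSpace ℝ (Fin N) =>
        (s.1.1, s.1.2.1, s.1.2.2, s.2.1)) h (by fun_prop)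
  rcases lt_or_ge (-‖z‖) (inner ℝ z x : ℝ) with hlt | hge
  · obtain ⟨y, hy, hneg, hpos⟩ := exists_inner_mul_inner_lt hx hp hzx hlt
    -- The first step already succeeds; any unit vector may serve as the second, since the inner
    -- product cannot fall again.
    refine ⟨y, p, hy, hp, ?_⟩
    have hc : ContinuousAt (fun s : (EuclideanSpace ℝ (Fin N) × EuclideanSpace ℝ (Fin N) ×
        EuclideanSpace ℝ (Fin N)) × EuclideanSpace ℝ (Fin N) × EuclideanSpace ℝ (Fin N) =>
        (inner ℝ (signStep s.1.1 s.1.2.1 s.1.2.2 s.2.1) s.1.1 : ℝ)) ((x, p, z), (y, p)) :=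
      (hfst y p hneg).inner (by fun_prop)
    filter_upwards [continuousAt_const.eventually_lt hc hpos] with s hs
    exact hs.trans_le (inner_le_inner_signStep _ _ _ _)
  · obtain ⟨y, hy, hneg, hle, hgt⟩ :=
      exists_signStep_not_antiparallel hN hx hp hz (eq_neg_smul_of_inner_le hx hge)
    obtain ⟨y', hy', hneg', hpos⟩ := exists_inner_mul_inner_lt hx hp hle hgt
    refine ⟨y, y', hy, hy', ?_⟩
    have h2 := continuousAt_signStep (x, p, signStep x p z y, y') hneg'
    have h3 := ContinuousAt.comp' (x := ((x, p, z), (y, y')))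
      (f := fun s : (EuclideanSpace ℝ (Fin N) × EuclideanSpace ℝ (Fin N) ×
        EuclideanSpace ℝ (Fin N)) × EuclideanSpace ℝ (Fin N) × EuclideanSpace ℝ (Fin N) =>
        (s.1.1, s.1.2.1, signStep s.1.1 s.1.2.1 s.1.2.2 s.2.1, s.2.2)) h2
      (ContinuousAt.prodMk (by fun_prop) (ContinuousAt.prodMk (by fun_prop)
        (ContinuousAt.prodMk (hfst y y' hneg) (by fun_prop))))
    have hc := h3.inner (𝕜 := ℝ) (g := fun s => s.1.1) (by fun_prop)
    exact continuousAt_const.eventually_lt hc hpos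

end Geometry

/-! ### Measurability of the step -/

section Measurability

variable {N : ℕ}

lemma measurableSet_sign_ne {α : Type*} [MeasurableSpace α] {f g : α → ℝ} (hf : Measurable f)
    (hg : Measurable g) : MeasurableSet {a | SignType.sign (f a) ≠ SignType.sign (g a)} := by
  have h : {a | SignType.sign (f a) ≠ SignType.sign (g a)} =
      ({a | 0 < f a} ∩ {a | 0 < g a} ∪ {a | f a < 0} ∩ {a | g a < 0} ∪
        {a | f a = 0} ∩ {a | g a = 0})ᶜ := by
    ext a
    simp only [Set.mem_ofPred_eq, Set.mem_compl_iff, Set.mem_union, Set.mem_inter_iff, ne_eq,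
      not_iff_not]
    have e₁ : (1 : SignType) ≠ -1 := by decide
    have e₂ : (1 : SignType) ≠ 0 := by decide
    have e₃ : (-1 : SignType) ≠ 0 := by decide
    simp only [sign_apply]
    grind
  rw [h]
  refine (((measurableSet_lt measurable_const hf).inter (measurableSet_lt measurable_const hg)).union
    ((measurableSet_lt hf measurable_const).inter (measurableSet_lt hg measurable_const))).union
    ((measurableSet_eq_fun hf measurable_const).inter
      (measurableSet_eq_fun hg measurable_const)) |>.compl

lemma measurable_signStep {α : Type*} [MeasurableSpace α]
    {x p z y : α → EuclideanSpace ℝ (Fin N)} (hx : Measurable x) (hp : Measurable p)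
    (hz : Measurable z) (hy : Measurable y) :
    Measurable fun a => signStep (x a) (p a) (z a) (y a) := by
  unfold signStep projectionStep
  exact Measurable.ite (measurableSet_sign_ne (by fun_prop) (by fun_prop)) (by fun_prop) hz

lemma measurable_sqDistLine {α : Type*} [MeasurableSpace α]
    {x z : α → EuclideanSpace ℝ (Fin N)} (hx : Measurable x) (hz : Measurable z) :
    Measurable fun a => sqDistLine (x a) (z a) := by
  unfold sqDistLine
  fun_prop

end Measurability

/-! ### The uniform measure: null points, open sets, and lower bounds for windows -/

section UniformSphere

variable {N : ℕ}

/-- Surface measure is the volume of a cone in the unit ball; describing the cone by radial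
projection prepares it for Fubini. -/
lemma uniformSphere_apply {V : Set (EuclideanSpace ℝ (Fin N))} (hV : MeasurableSet V) :
    uniformSphere N V = ((volume : Measure (EuclideanSpace ℝ (Fin N))).toSphere Set.univ)⁻¹ *
      (N * volume {G : EuclideanSpace ℝ (Fin N) | 0 < ‖G‖ ∧ ‖G‖ < 1 ∧ ‖G‖⁻¹ • G ∈ V}) := by
  have hV' : MeasurableSet ((Subtype.val : Metric.sphere (0 : EuclideanSpace ℝ (Fin N)) 1 → _) ⁻¹' V) :=
    measurable_subtype_coe hV
  rw [uniformSphere, Measure.smul_apply, Measure.map_apply measurable_subtype_coe hV,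
    Measure.toSphere_apply' _ hV', finrank_euclideanSpace_fin, smul_eq_mul]
  congr 3
  ext G
  rw [Set.mem_smul]
  constructor
  · rintro ⟨t, ⟨ht0, ht1⟩, _, ⟨v, hv, rfl⟩, rfl⟩
    have hv1 : ‖(v : EuclideanSpace ℝ (Fin N))‖ = 1 := by simp
    have hn : ‖t • (v : EuclideanSpace ℝ (Fin N))‖ = t := by
      rw [norm_smul, hv1, Real.norm_eq_abs, abs_of_pos ht0, mul_one]
    refine ⟨by rwa [hn], by rwa [hn], ?_⟩
    rw [hn, smul_smul, inv_mul_cancel₀ ht0.ne', one_smul]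
    exact hv
  · rintro ⟨h0, h1, h2⟩
    refine ⟨‖G‖, ⟨h0, h1⟩, ‖G‖⁻¹ • G, ⟨⟨‖G‖⁻¹ • G, ?_⟩, h2, rfl⟩, ?_⟩
    · rw [mem_sphere_zero_iff_norm, norm_smul, norm_inv, norm_norm, inv_mul_cancel₀ h0.ne']
    · rw [smul_smul, mul_inv_cancel₀ h0.ne', one_smul]

lemma toSphere_univ_ne_zero (hN : 2 ≤ N) :
    (volume : Measure (EuclideanSpace ℝ (Fin N))).toSphere Set.univ ≠ 0 := by
  have : Nonempty (Fin N) := ⟨⟨0, by omega⟩⟩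
  have : Nontrivial (EuclideanSpace ℝ (Fin N)) := inferInstance
  rw [Measure.measure_univ_ne_zero]
  exact Measure.toSphere_ne_zero _

lemma isProbabilityMeasure_uniformSphere (hN : 2 ≤ N) :
    IsProbabilityMeasure (uniformSphere N) := by
  refine ⟨?_⟩
  rw [uniformSphere, Measure.smul_apply, Measure.map_apply measurable_subtype_coe .univ,
    Set.preimage_univ, smul_eq_mul]
  exact ENNReal.inv_mul_cancel (toSphere_univ_ne_zero hN) (measure_ne_top _ _)

lemma ae_norm_eq_one_uniformSphere : ∀ᵐ y ∂uniformSphere N, ‖y‖ = 1 := by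
  rw [uniformSphere]
  refine Measure.ae_smul_measure ?_ _
  rw [ae_map_iff measurable_subtype_coe.aemeasurable
    (measurableSet_eq_fun measurable_norm measurable_const)]
  exact Eventually.of_forall fun v => by simp

lemma uniformSphere_singleton (hN : 2 ≤ N) (y : EuclideanSpace ℝ (Fin N)) :
    uniformSphere N {y} = 0 := by
  rw [uniformSphere_apply (measurableSet_singleton y)]
  have h : volume {G : EuclideanSpace ℝ (Fin N) | 0 < ‖G‖ ∧ ‖G‖ < 1 ∧ ‖G‖⁻¹ • G ∈ ({y} : Set _)} = 0 := by
    refine measure_mono_null (t := ((ℝ ∙ y : Submodule ℝ (EuclideanSpace ℝ (Fin N))) : Set _)) ?_ ?_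
    · rintro G ⟨h0, -, h2⟩
      rw [Set.mem_singleton_iff] at h2
      rw [SetLike.mem_coe, Submodule.mem_span_singleton]
      exact ⟨‖G‖, by rw [← h2, smul_smul, mul_inv_cancel₀ h0.ne', one_smul]⟩
    · refine Measure.addHaar_submodule _ _ fun htop => ?_
      have h1 := finrank_span_le_card (R := ℝ) ({y} : Set (EuclideanSpace ℝ (Fin N)))
      rw [htop, finrank_top, finrank_euclideanSpace_fin] at h1
      simp at h1
      omega
  rw [h, mul_zero, mul_zero]

lemma uniformSphere_pos_of_mem_nhds {y : EuclideanSpace ℝ (Fin N)} (hy : ‖y‖ = 1)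
    {V : Set (EuclideanSpace ℝ (Fin N))} (hV : V ∈ 𝓝 y) : 0 < uniformSphere N V := by
  obtain ⟨U, hUV, hUo, hyU⟩ := mem_nhds_iff.1 hV
  refine lt_of_lt_of_le ?_ (measure_mono hUV)
  rw [uniformSphere, Measure.smul_apply, Measure.map_apply measurable_subtype_coe hUo.measurableSet,
    smul_eq_mul]
  have hne : ((Subtype.val : Metric.sphere (0 : EuclideanSpace ℝ (Fin N)) 1 → _) ⁻¹' U).Nonempty :=
    ⟨⟨y, by simpa using hy⟩, hyU⟩
  exact ENNReal.mul_pos (ENNReal.inv_ne_zero.2 (measure_ne_top _ _))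
    ((hUo.preimage continuous_subtype_val).measure_pos _ hne).ne'

/-- Lower bound for a volume by the lengths of the chords in a fixed direction. -/
lemma volume_mul_le_of_chords {A B : Set (EuclideanSpace ℝ (Fin N))} (hA : MeasurableSet A)
    (hB : MeasurableSet B) (x : EuclideanSpace ℝ (Fin N)) (l : ENNReal)
    (h : ∀ y ∈ B, l ≤ volume ({s : ℝ | y + s • x ∈ A} ∩ Set.Ioo (-2) 2)) :
    l * volume B ≤ 4 * volume A := by
  have hm : Measurable fun q : EuclideanSpace ℝ (Fin N) × ℝ =>
      A.indicator (fun _ => (1 : ENNReal)) (q.1 + q.2 • x) :=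
    (measurable_const.indicator hA).comp (by fun_prop)
  have h1 : ∀ y, ∫⁻ s in Set.Ioo (-2 : ℝ) 2, A.indicator (fun _ => (1 : ENNReal)) (y + s • x) =
      volume ({s : ℝ | y + s • x ∈ A} ∩ Set.Ioo (-2) 2) := by
    intro y
    have hms : MeasurableSet {s : ℝ | y + s • x ∈ A} := (show Measurable fun s : ℝ => y + s • x by fun_prop) hA
    rw [← Measure.restrict_apply hms, ← lintegral_indicator_one hms]
    rfl
  have h2 : ∀ s : ℝ, ∫⁻ y, A.indicator (fun _ => (1 : ENNReal)) (y + s • x) = volume A := by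
    intro s
    rw [lintegral_add_right_eq_self (fun y => A.indicator (fun _ => (1 : ENNReal)) y)]
    exact lintegral_indicator_one hA
  -- After swapping the integrals, each `s` contributes the volume of a translate of `A`, and `s`
  -- runs over an interval of length `4`.
  calc l * volume B = ∫⁻ _ in B, l := by rw [lintegral_const, Measure.restrict_apply_univ]
    _ ≤ ∫⁻ y in B, ∫⁻ s in Set.Ioo (-2 : ℝ) 2, A.indicator (fun _ => (1 : ENNReal)) (y + s • x) :=
        setLIntegral_mono' hB fun y hy => by rw [h1]; exact h y hy
    _ ≤ ∫⁻ y, ∫⁻ s in Set.Ioo (-2 : ℝ) 2, A.indicator (fun _ => (1 : ENNReal)) (y + s • x) :=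
        setLIntegral_le_lintegral _ _
    _ = ∫⁻ s in Set.Ioo (-2 : ℝ) 2, ∫⁻ y, A.indicator (fun _ => (1 : ENNReal)) (y + s • x) :=
        lintegral_lintegral_swap hm.aemeasurable
    _ = 4 * volume A := by
        simp_rw [h2]
        rw [setLIntegral_const, Real.volume_Ioo, mul_comm]
        norm_num

/-- Planar picture: on the line at distance `h` from the axis, the point at radius `R₁` has slope
(axial coordinate over radius) exactly `b`. Moving back by `σ` changes the radius by at most `σ`; as
`|b| < 1` the slope drops below `b`, and by less than `η` because `2σ < ηh ≤ ηR`. -/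
lemma slope_window {b r h η R₁ σ R : ℝ} (hr : 0 < r) (hb : r ^ 2 ≤ 1 - b ^ 2) (hh : 0 < h)
    (hη : 0 < η) (hR₁ : 0 ≤ R₁) (hR₁' : R₁ ^ 2 * (1 - b ^ 2) = h ^ 2) (hσ : 0 < σ)
    (hσ' : σ < η * h / 2) (hR : 0 ≤ R) (hR' : R ^ 2 = (b * R₁ - σ) ^ 2 + h ^ 2) :
    (b - η) * R < b * R₁ - σ ∧ b * R₁ - σ < b * R ∧ R ≤ R₁ + σ := by
  have hb2 : b ^ 2 < 1 := by nlinarith [sq_pos_of_pos hr]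
  have hb1 : |b| < 1 := (sq_lt_one_iff_abs_lt_one b).1 hb2
  obtain ⟨hbl, hbu⟩ := abs_lt.1 hb1
  have hhR : h ≤ R := by
    refine le_of_sq_le_sq ?_ hR
    nlinarith [sq_nonneg (b * R₁ - σ)]
  have hRpos : 0 < R := hh.trans_le hhR
  have hsR : |b * R₁ - σ| ≤ R := by
    refine abs_le_of_sq_le_sq ?_ hR
    nlinarith
  have hs₁ : |b * R₁| ≤ R₁ := by
    rw [abs_mul, abs_of_nonneg hR₁]
    nlinarith [abs_nonneg b]
  have htri : |R - R₁| ≤ σ := by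
    have e : (R - R₁) * (R + R₁) = -σ * ((b * R₁ - σ) + b * R₁) := by nlinarith
    have h1 : |R - R₁| * (R + R₁) ≤ σ * (R + R₁) := by
      rw [← abs_of_pos (show 0 < R + R₁ by linarith), ← abs_mul, e, abs_mul, abs_neg,
        abs_of_pos hσ, abs_of_pos (show 0 < R + R₁ by linarith)]
      exact mul_le_mul_of_nonneg_left ((abs_add_le _ _).trans (add_le_add hsR hs₁)) hσ.le
    exact le_of_mul_le_mul_right h1 (by linarith)
  obtain ⟨ht1, ht2⟩ := abs_le.1 htri
  have hbt : |b * (R₁ - R)| < σ := by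
    rw [abs_mul, abs_sub_comm]
    rcases eq_or_lt_of_le (abs_nonneg (R - R₁)) with h0 | h0
    · rw [← h0, mul_zero]; exact hσ
    · nlinarith
  obtain ⟨hb3, hb4⟩ := abs_lt.1 hbt
  refine ⟨?_, by linarith, by linarith⟩
  nlinarith

/-- A line in the direction `x` that meets a small ball centred on the ray through `e` meets the
open unit ball, inside the cone over a window, in a segment of length of order `η`. -/
lemma exists_chord_subset_cone {r : ℝ} (hr0 : 0 < r) (hr1 : r ≤ 1)
    {x e y : EuclideanSpace ℝ (Fin N)} {b η : ℝ} (hx : ‖x‖ = 1) (he : ‖e‖ = 1)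
    (hxe : (inner ℝ x e : ℝ) = 0) (hb : r ^ 2 ≤ 1 - b ^ 2) (hη : 0 < η) (hη1 : η ≤ 1)
    (hy : ‖y - (r / 4) • e‖ < r / 8) :
    ∃ s₀ : ℝ, Set.Ioo (s₀ - η * r / 16) s₀ ⊆
      {s : ℝ | 0 < ‖y + s • x‖ ∧ ‖y + s • x‖ < 1 ∧
        b - η < (inner ℝ x (‖y + s • x‖⁻¹ • (y + s • x)) : ℝ) ∧
        (inner ℝ x (‖y + s • x‖⁻¹ • (y + s • x)) : ℝ) < b ∧
        r / 8 ≤ (inner ℝ e (‖y + s • x‖⁻¹ • (y + s • x)) : ℝ)} ∩ Set.Ioo (-2) 2 := by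
  set d := y - (r / 4) • e with hd
  have hyd : y = (r / 4) • e + d := by rw [hd]; abel
  have hxd : |(inner ℝ x d : ℝ)| < r / 8 := by
    have := abs_real_inner_le_norm x d
    rw [hx, one_mul] at this
    linarith
  have hed : |(inner ℝ e d : ℝ)| < r / 8 := by
    have := abs_real_inner_le_norm e d
    rw [he, one_mul] at this
    linarith
  have hxy : (inner ℝ x y : ℝ) = inner ℝ x d := by
    rw [hyd, inner_add_right, real_inner_smul_right, hxe]; ring
  have hey : (inner ℝ e y : ℝ) = r / 4 + inner ℝ e d := by
    rw [hyd, inner_add_right, real_inner_smul_right, real_inner_self_eq_norm_sq, he]; ring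
  have hey' : r / 8 ≤ (inner ℝ e y : ℝ) := by linarith [(abs_lt.1 hed).1]
  have hyn : ‖y‖ ≤ 3 * r / 8 := by
    have := norm_add_le ((r / 4) • e) d
    rw [← hyd, norm_smul, he, Real.norm_eq_abs, abs_of_pos (by positivity)] at this
    linarith
  set α := (inner ℝ x y : ℝ) with hα
  set β := (inner ℝ e y : ℝ) with hβ
  -- Bessel's inequality for `x`, `e`: the distance `h` from `y` to the axis is at least `β ≥ r /
  -- 8`.
  have hbessel : 0 ≤ ‖y‖ ^ 2 - α ^ 2 - β ^ 2 := by
    have h0 := sq_nonneg ‖y - (α • x + β • e)‖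
    rw [norm_sub_sq_real, norm_add_sq_real, inner_add_right, real_inner_smul_right,
      real_inner_smul_right, real_inner_smul_left, real_inner_smul_right, hxe, norm_smul,
      norm_smul, hx, he, real_inner_comm x y, real_inner_comm e y] at h0
    simp only [Real.norm_eq_abs, mul_one, sq_abs, mul_zero] at h0
    nlinarith
  set h := Real.sqrt (‖y‖ ^ 2 - α ^ 2) with hh
  have hh2 : h ^ 2 = ‖y‖ ^ 2 - α ^ 2 := Real.sq_sqrt (by nlinarith [sq_nonneg β])
  have hhl : r / 8 ≤ h := by
    refine le_of_sq_le_sq ?_ (Real.sqrt_nonneg _)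
    rw [hh2]; nlinarith
  have hhpos : 0 < h := by linarith
  have hhu : h ≤ 3 * r / 8 := by
    refine le_of_sq_le_sq ?_ (by positivity)
    rw [hh2]
    have : ‖y‖ ^ 2 ≤ (3 * r / 8) ^ 2 := by gcongr
    nlinarith [sq_nonneg α]
  have hb0 : 0 < 1 - b ^ 2 := by nlinarith [sq_pos_of_pos hr0]
  set R₁ := h / Real.sqrt (1 - b ^ 2) with hR₁
  have hR₁0 : 0 ≤ R₁ := by positivity
  have hR₁2 : R₁ ^ 2 * (1 - b ^ 2) = h ^ 2 := by
    rw [hR₁, div_pow, Real.sq_sqrt hb0.le]; field_simp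
  -- The bound `r² ≤ 1 - b²` enters here: it keeps the segment inside the unit ball.
  have hR₁u : R₁ ≤ 3 / 8 := by
    refine le_of_sq_le_sq ?_ (by norm_num)
    have h1 : R₁ ^ 2 * r ^ 2 ≤ h ^ 2 := by
      rw [← hR₁2]; gcongr
    have h2 : h ^ 2 ≤ (3 / 8) ^ 2 * r ^ 2 := by
      rw [← mul_pow]; gcongr; linarith
    exact le_of_mul_le_mul_right (h1.trans h2) (by positivity)
  -- The parameter at which the slope equals `b`; the length `η r / 16` is at most `η h / 2`.
  refine ⟨b * R₁ - α, ?_⟩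
  · rintro s ⟨hs1', hs2⟩
    have hs1 : b * R₁ - α - η * h / 2 < s := by nlinarith
    set σ := b * R₁ - α - s with hσ
    have hGx : (inner ℝ x (y + s • x) : ℝ) = b * R₁ - σ := by
      rw [inner_add_right, real_inner_smul_right, real_inner_self_eq_norm_sq, hx, hσ]; ring
    have hGe : (inner ℝ e (y + s • x) : ℝ) = β := by
      rw [inner_add_right, real_inner_smul_right, real_inner_comm x e, hxe, hβ]; ring
    have hG2 : ‖y + s • x‖ ^ 2 = (b * R₁ - σ) ^ 2 + h ^ 2 := by
      rw [norm_add_sq_real, real_inner_smul_right, norm_smul, hx, mul_one, Real.norm_eq_abs,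
        sq_abs, hh2, real_inner_comm, hσ]
      ring
    obtain ⟨w1, w2, w3⟩ := slope_window hr0 hb hhpos hη hR₁0 hR₁2 (by linarith) (by linarith)
      (norm_nonneg _) hG2
    have hηh : η * h ≤ 1 * (3 / 8) := by gcongr; linarith
    have hσu : σ < 3 / 16 := by linarith
    have hG1 : ‖y + s • x‖ < 1 := by linarith
    have hG0 : 0 < ‖y + s • x‖ := by
      refine lt_of_pow_lt_pow_left₀ 2 (norm_nonneg _) ?_
      rw [hG2, zero_pow two_ne_zero]; positivity
    have hiG : |(inner ℝ x (y + s • x) : ℝ)| ≤ ‖y + s • x‖ := by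
      have := abs_real_inner_le_norm x (y + s • x)
      rwa [hx, one_mul] at this
    have hs : s = (inner ℝ x (y + s • x) : ℝ) - inner ℝ x d := by
      rw [hGx, hσ, ← hxy]; ring
    refine ⟨⟨hG0, hG1, ?_, ?_, ?_⟩, ?_, ?_⟩
    · rw [real_inner_smul_right, hGx, inv_mul_eq_div, lt_div_iff₀ hG0]; exact w1
    · rw [real_inner_smul_right, hGx, inv_mul_eq_div, div_lt_iff₀ hG0]; exact w2
    · rw [real_inner_smul_right, hGe, inv_mul_eq_div, le_div_iff₀ hG0]
      exact (mul_le_of_le_one_right (by positivity) hG1.le).trans hey'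
    · rw [hs]; linarith [(abs_le.1 hiG).1, (abs_lt.1 hxd).2]
    · rw [hs]; linarith [(abs_le.1 hiG).2, (abs_lt.1 hxd).1]

/-- A window of width `η` in the direction `x`, cut with a cap in an orthogonal direction, has
measure at least of order `η`. -/
lemma exists_le_uniformSphere_window (hN : 2 ≤ N) {r : ℝ} (hr0 : 0 < r) (hr1 : r ≤ 1) :
    ∃ c : ℝ, 0 < c ∧ ∀ (x e : EuclideanSpace ℝ (Fin N)) (b η : ℝ), ‖x‖ = 1 → ‖e‖ = 1 →
      (inner ℝ x e : ℝ) = 0 → r ^ 2 ≤ 1 - b ^ 2 → 0 < η → η ≤ 1 →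
      c * η ≤ (uniformSphere N).real {y | b - η < (inner ℝ x y : ℝ) ∧ (inner ℝ x y : ℝ) < b ∧
        r / 8 ≤ (inner ℝ e y : ℝ)} := by
  have := isProbabilityMeasure_uniformSphere hN
  set K : ENNReal :=
    ((volume : Measure (EuclideanSpace ℝ (Fin N))).toSphere Set.univ)⁻¹ * N with hK
  have hK0 : K ≠ 0 := mul_ne_zero (ENNReal.inv_ne_zero.2 (measure_ne_top _ _))
    (by simp; omega)
  have hKt : K ≠ ⊤ := ENNReal.mul_ne_top (ENNReal.inv_ne_top.2 (toSphere_univ_ne_zero hN)) (by simp)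
  clear_value K
  set vB : ENNReal := volume (Metric.ball (0 : EuclideanSpace ℝ (Fin N)) (r / 8)) with hvB
  have hvB0 : vB ≠ 0 := (Metric.measure_ball_pos volume _ (by positivity)).ne'
  have hvBt : vB ≠ ⊤ := measure_ball_lt_top.ne
  -- Chord length `η r / 16`, divided by the length `4` of the parameter interval.
  refine ⟨K.toReal * vB.toReal * (r / 64), ?_, ?_⟩
  · have := ENNReal.toReal_pos hK0 hKt
    have := ENNReal.toReal_pos hvB0 hvBt
    positivity
  intro x e b η hx he hxe hb hη hη1
  set V : Set (EuclideanSpace ℝ (Fin N)) := {y | b - η < (inner ℝ x y : ℝ) ∧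
    (inner ℝ x y : ℝ) < b ∧ r / 8 ≤ (inner ℝ e y : ℝ)} with hV
  have hmx : Measurable fun y : EuclideanSpace ℝ (Fin N) => (inner ℝ x y : ℝ) := by fun_prop
  have hme : Measurable fun y : EuclideanSpace ℝ (Fin N) => (inner ℝ e y : ℝ) := by fun_prop
  have hVm : MeasurableSet V :=
    (measurableSet_lt measurable_const hmx).inter
      ((measurableSet_lt hmx measurable_const).inter (measurableSet_le measurable_const hme))
  set A : Set (EuclideanSpace ℝ (Fin N)) := {G | 0 < ‖G‖ ∧ ‖G‖ < 1 ∧ ‖G‖⁻¹ • G ∈ V} with hA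
  have hAm : MeasurableSet A :=
    (measurableSet_lt measurable_const measurable_norm).inter
      ((measurableSet_lt measurable_norm measurable_const).inter
        ((show Measurable fun G : EuclideanSpace ℝ (Fin N) => ‖G‖⁻¹ • G by fun_prop) hVm))
  have hchord := volume_mul_le_of_chords hAm
    (Metric.isOpen_ball (x := (r / 4) • e) (ε := r / 8)).measurableSet x
    (ENNReal.ofReal (η * r / 16)) ?_
  · have hvBe : volume (Metric.ball ((r / 4) • e) (r / 8)) = vB :=
      Measure.addHaar_ball_center _ _ _
    rw [hvBe] at hchord
    have hAt : volume A ≠ ⊤ := by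
      refine ((measure_mono ?_).trans_lt
        (measure_ball_lt_top (μ := volume) (x := (0 : EuclideanSpace ℝ (Fin N))) (r := 1))).ne
      intro G hG
      simpa using hG.2.1
    have h3 := ENNReal.toReal_mono (ENNReal.mul_ne_top (by simp) hAt) hchord
    rw [ENNReal.toReal_mul, ENNReal.toReal_mul, ENNReal.toReal_ofReal (by positivity)] at h3
    rw [measureReal_def, uniformSphere_apply hVm, ← mul_assoc, ← hK, ENNReal.toReal_mul, mul_assoc,
      mul_assoc]
    refine mul_le_mul_of_nonneg_left ?_ ENNReal.toReal_nonneg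
    norm_num at h3
    linarith
  · intro y hy
    obtain ⟨s₀, hs₀⟩ := exists_chord_subset_cone hr0 hr1 hx he hxe hb hη hη1
      (mem_ball_iff_norm.1 hy)
    refine le_trans ?_ (measure_mono hs₀)
    rw [Real.volume_Ioo]
    exact ENNReal.ofReal_le_ofReal (by linarith)

end UniformSphere

/-! ### Expected decrease of the squared distance in one step -/

section Decrease

variable {N : ℕ}

/-- Write `z = a x + d e` with `e` a unit vector orthogonal to `x` and `d = √D`. If `⟨e, p⟩ ≤ 0`,
take `y` just below `p` in direction `x`, within `r d / 16`, and with `⟨e, y⟩ ≥ r / 8`. Then `⟨x, ψ⟩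
< 0`, while `⟨z, ψ⟩ ≥ d r / 8 - d r / 16 > 0`. -/
lemma exists_cut_of_inner_nonpos {r c : ℝ} (hr0 : 0 < r) (hr1 : r ≤ 1)
    (hc : ∀ (x e : EuclideanSpace ℝ (Fin N)) (b η : ℝ), ‖x‖ = 1 → ‖e‖ = 1 →
      (inner ℝ x e : ℝ) = 0 → r ^ 2 ≤ 1 - b ^ 2 → 0 < η → η ≤ 1 →
      c * η ≤ (uniformSphere N).real {y | b - η < (inner ℝ x y : ℝ) ∧ (inner ℝ x y : ℝ) < b ∧
        r / 8 ≤ (inner ℝ e y : ℝ)})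
    {x p z : EuclideanSpace ℝ (Fin N)} (hx : ‖x‖ = 1) (hz : ‖z‖ ≤ 1)
    (hD : 0 < sqDistLine x z) (hxp : r ^ 2 ≤ 1 - (inner ℝ x p : ℝ) ^ 2)
    (hs : (inner ℝ (z - (inner ℝ z x : ℝ) • x) p : ℝ) ≤ 0) :
    ∃ W : Set (EuclideanSpace ℝ (Fin N)), MeasurableSet W ∧
      c * (r / 16 * √(sqDistLine x z)) ≤ (uniformSphere N).real W ∧
      ∀ y ∈ W, (inner ℝ z (y - p) : ℝ) * inner ℝ x (y - p) < 0 ∧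
        (r / 16) ^ 2 * sqDistLine x z ≤ (inner ℝ z (y - p) : ℝ) ^ 2 := by
  set a := (inner ℝ z x : ℝ) with ha
  set d := √(sqDistLine x z) with hd
  have hd0 : 0 < d := Real.sqrt_pos.2 hD
  have hd2 : d ^ 2 = sqDistLine x z := Real.sq_sqrt hD.le
  have hd1 : d ≤ 1 := by
    refine Real.sqrt_le_one.2 (sqDistLine_le.trans ?_)
    exact pow_le_one₀ (norm_nonneg _) hz
  have ha1 : |a| ≤ 1 := by
    have := abs_real_inner_le_norm z x
    rw [hx, mul_one] at this
    exact this.trans hz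
  set w := z - a • x with hw
  have hwn : ‖w‖ = d := by
    have h2 : ‖w‖ ^ 2 = d ^ 2 := by
      rw [hd2, hw, norm_sub_sq_real, real_inner_smul_right, norm_smul, hx, mul_one,
        Real.norm_eq_abs, sq_abs, sqDistLine, ← ha]; ring
    exact (sq_eq_sq₀ (norm_nonneg _) hd0.le).1 h2
  have hxw : (inner ℝ x w : ℝ) = 0 := by
    rw [hw, inner_sub_right, real_inner_smul_right, real_inner_self_eq_norm_sq, hx,
      real_inner_comm, ha]; ring
  set e := d⁻¹ • w with he
  have hen : ‖e‖ = 1 := by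
    rw [he, norm_smul, hwn, Real.norm_eq_abs, abs_of_pos (inv_pos.2 hd0), inv_mul_cancel₀ hd0.ne']
  have hxe : (inner ℝ x e : ℝ) = 0 := by rw [he, real_inner_smul_right, hxw, mul_zero]
  have hep : (inner ℝ e p : ℝ) ≤ 0 := by
    rw [he, real_inner_smul_left]
    exact mul_nonpos_of_nonneg_of_nonpos (inv_pos.2 hd0).le hs
  have hzd : z = a • x + d • e := by
    rw [he, smul_smul, mul_inv_cancel₀ hd0.ne', one_smul, hw]; abel
  have hmx : Measurable fun y : EuclideanSpace ℝ (Fin N) => (inner ℝ x y : ℝ) := by fun_prop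
  have hme : Measurable fun y : EuclideanSpace ℝ (Fin N) => (inner ℝ e y : ℝ) := by fun_prop
  refine ⟨_, (measurableSet_lt measurable_const hmx).inter
      ((measurableSet_lt hmx measurable_const).inter (measurableSet_le measurable_const hme)),
    hc x e (inner ℝ x p) (r / 16 * d) hx hen hxe hxp (by positivity) (by nlinarith), ?_⟩
  rintro y ⟨h1, h2, h3⟩
  rw [Set.mem_ofPred_eq] at h1 h2 h3
  have hψx : -(r / 16 * d) < (inner ℝ x (y - p) : ℝ) := by rw [inner_sub_right]; linarith
  have hψx0 : (inner ℝ x (y - p) : ℝ) < 0 := by rw [inner_sub_right]; linarith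
  have hψe : r / 8 ≤ (inner ℝ e (y - p) : ℝ) := by rw [inner_sub_right]; linarith
  have hzψ : (inner ℝ z (y - p) : ℝ) = a * inner ℝ x (y - p) + d * inner ℝ e (y - p) := by
    rw [hzd, inner_add_left, real_inner_smul_left, real_inner_smul_left]
  have hlow : r / 16 * d ≤ (inner ℝ z (y - p) : ℝ) := by
    rw [hzψ]
    have e1 : -(r / 16 * d) ≤ a * inner ℝ x (y - p) := by
      have h4 : |a * (inner ℝ x (y - p) : ℝ)| ≤ 1 * (r / 16 * d) := by
        rw [abs_mul]
        refine mul_le_mul ha1 ?_ (abs_nonneg _) zero_le_one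
        rw [abs_of_neg hψx0]; linarith
      linarith [(abs_le.1 h4).1]
    have e2 : d * (r / 8) ≤ d * inner ℝ e (y - p) := by gcongr
    linarith
  have hpos : 0 < r / 16 * d := by positivity
  refine ⟨mul_neg_of_pos_of_neg (by linarith) hψx0, ?_⟩
  rw [← hd2, ← mul_pow]
  gcongr

lemma sqDistLine_neg_neg (x z : EuclideanSpace ℝ (Fin N)) :
    sqDistLine (-x) (-z) = sqDistLine x z := by
  rw [sqDistLine, sqDistLine, norm_neg, inner_neg_neg]

/-- The expected squared distance to the line through `x` drops by at least the order of its power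
`3 / 2` in one step. -/
lemma exists_integral_sqDistLine_signStep_le (hN : 2 ≤ N) {r : ℝ} (hr0 : 0 < r) (hr1 : r ≤ 1) :
    ∃ γ : ℝ, 0 < γ ∧ ∀ x p z : EuclideanSpace ℝ (Fin N), ‖x‖ = 1 → ‖p‖ = 1 → ‖z‖ ≤ 1 →
      0 ≤ (inner ℝ z x : ℝ) → r ^ 2 ≤ 1 - (inner ℝ x p : ℝ) ^ 2 →
      ∫ y, sqDistLine x (signStep x p z y) ∂uniformSphere N ≤
        sqDistLine x z - γ * (sqDistLine x z * √(sqDistLine x z)) := by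
  have := isProbabilityMeasure_uniformSphere hN
  obtain ⟨c, hc0, hc⟩ := exists_le_uniformSphere_window hN hr0 hr1
  -- Probability at least `c (r / 16) √D`, times a drop of at least `(r / 16)² D / 4`, since `‖y -
  -- p‖² ≤ 4`.
  refine ⟨c * (r / 16) ^ 3 / 4, by positivity, ?_⟩
  intro x p z hx hp hz hzx hxp
  have hint : Integrable (fun y => sqDistLine x (signStep x p z y)) (uniformSphere N) := by
    refine Integrable.of_bound (C := 1) (measurable_sqDistLine measurable_const
      (measurable_signStep measurable_const measurable_const measurable_const
        measurable_id)).aestronglyMeasurable (Eventually.of_forall fun y => ?_)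
    rw [Real.norm_eq_abs, abs_of_nonneg (sqDistLine_nonneg hx)]
    exact sqDistLine_le.trans (pow_le_one₀ (norm_nonneg _) ((norm_signStep_le _ _ _ _).trans hz))
  rcases (sqDistLine_nonneg (z := z) hx).eq_or_lt with h0 | hD
  · rw [← h0]
    simp only [Real.sqrt_zero, mul_zero, sub_zero]
    refine integral_nonpos fun y => ?_
    rw [Pi.zero_apply, h0]
    exact sqDistLine_signStep_le hzx
  obtain ⟨W, hWm, hWc, hW⟩ : ∃ W : Set (EuclideanSpace ℝ (Fin N)), MeasurableSet W ∧
      c * (r / 16 * √(sqDistLine x z)) ≤ (uniformSphere N).real W ∧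
      ∀ y ∈ W, (inner ℝ z (y - p) : ℝ) * inner ℝ x (y - p) < 0 ∧
        (r / 16) ^ 2 * sqDistLine x z ≤ (inner ℝ z (y - p) : ℝ) ^ 2 := by
    rcases le_total (inner ℝ (z - (inner ℝ z x : ℝ) • x) p : ℝ) 0 with hs | hs
    · exact exists_cut_of_inner_nonpos hr0 hr1 hc hx hz hD hxp hs
    -- Replacing `(x, z)` by `(-x, -z)` flips the sign of the orthogonal part and leaves every
    -- quantity in the conclusion unchanged.
    · have h := exists_cut_of_inner_nonpos (x := -x) (z := -z) (p := p) hr0 hr1 hc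
        (by rwa [norm_neg]) (by rwa [norm_neg]) (by rwa [sqDistLine_neg_neg])
        (by rwa [inner_neg_left, neg_sq]) (by
          rw [inner_neg_neg, smul_neg, ← neg_add', ← sub_eq_add_neg, inner_neg_left]
          linarith)
      simpa only [sqDistLine_neg_neg, inner_neg_left, neg_mul_neg, neg_sq] using h
  set D := sqDistLine x z with hDdef
  have hle : ∀ᵐ y ∂uniformSphere N, sqDistLine x (signStep x p z y) ≤
      D - W.indicator (fun _ => (r / 16) ^ 2 * D / 4) y := by
    filter_upwards [ae_norm_eq_one_uniformSphere] with y hy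
    by_cases hyW : y ∈ W
    · rw [Set.indicator_of_mem hyW]
      obtain ⟨h1, h2⟩ := hW y hyW
      refine (sqDistLine_signStep_le_sub hzx h1).trans (sub_le_sub_left ?_ _)
      have hne : y - p ≠ 0 := by intro h; simp [h] at h1
      have hn2 : ‖y - p‖ ^ 2 ≤ 4 := by
        have := norm_sub_le y p
        rw [hy, hp] at this
        nlinarith [norm_nonneg (y - p)]
      have hpos : 0 < ‖y - p‖ ^ 2 := by positivity
      gcongr
    · rw [Set.indicator_of_notMem hyW, sub_zero]
      exact sqDistLine_signStep_le hzx
  have hintW : Integrable (W.indicator (fun _ => (r / 16) ^ 2 * D / 4)) (uniformSphere N) :=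
    (integrable_const _).indicator hWm
  calc ∫ y, sqDistLine x (signStep x p z y) ∂uniformSphere N
      ≤ ∫ y, (D - W.indicator (fun _ => (r / 16) ^ 2 * D / 4) y) ∂uniformSphere N :=
        integral_mono_ae hint ((integrable_const _).sub hintW) hle
    _ = D - (uniformSphere N).real W * ((r / 16) ^ 2 * D / 4) := by
        rw [integral_sub (integrable_const _) hintW, integral_indicator_const _ hWm]
        simp
    _ ≤ D - c * (r / 16) ^ 3 / 4 * (D * √D) := by
        have := mul_le_mul_of_nonneg_right hWc
          (show 0 ≤ (r / 16) ^ 2 * D / 4 by positivity)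
        linarith

end Decrease

/-! ### Leaving the wrong half-space -/

section Escape

variable {N : ℕ}

/-- Homogeneity reduces the escape bound to unit `z`, hence to a compact set of parameters. -/
lemma signStep_smul {t : ℝ} (ht : 0 < t) (x p z y : EuclideanSpace ℝ (Fin N)) :
    signStep x p (t • z) y = t • signStep x p z y := by
  have hs : SignType.sign (inner ℝ (t • z) (y - p) : ℝ) = SignType.sign (inner ℝ z (y - p) : ℝ) := by
    rw [real_inner_smul_left, sign_mul, sign_pos ht, one_mul]
  by_cases h : SignType.sign (inner ℝ z (y - p) : ℝ) = SignType.sign (inner ℝ x (y - p) : ℝ)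
  · rw [signStep_of_eq h, signStep_of_eq (hs.trans h)]
  · rw [signStep_of_ne h, signStep_of_ne (hs ▸ h), real_inner_smul_left, smul_sub t z, smul_smul,
      mul_div_assoc]

/-- Two steps lead from the wrong half-space into the right one with a probability that is bounded
away from zero. -/
lemma exists_le_prod_two_steps_pos (hN : 2 ≤ N) :
    ∃ δ : ENNReal, 0 < δ ∧ ∀ x p z : EuclideanSpace ℝ (Fin N), ‖x‖ = 1 → ‖p‖ = 1 → z ≠ 0 →
      (inner ℝ z x : ℝ) ≤ 0 → δ ≤ ((uniformSphere N).prod (uniformSphere N))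
        {q | 0 < (inner ℝ (signStep x p (signStep x p z q.1) q.2) x : ℝ)} := by
  have := isProbabilityMeasure_uniformSphere hN
  set S := Metric.sphere (0 : EuclideanSpace ℝ (Fin N)) 1
  set K : Set (EuclideanSpace ℝ (Fin N) × EuclideanSpace ℝ (Fin N) × EuclideanSpace ℝ (Fin N)) :=
    (S ×ˢ S ×ˢ S) ∩ {s | (inner ℝ s.2.2 s.1 : ℝ) ≤ 0} with hK
  have hKc : IsCompact K :=
    ((isCompact_sphere _ _).prod ((isCompact_sphere _ _).prod (isCompact_sphere _ _))).inter_right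
      (isClosed_le (by fun_prop) continuous_const)
  have hmain : ∃ δ : ENNReal, 0 < δ ∧ ∀ s ∈ K, δ ≤ ((uniformSphere N).prod (uniformSphere N))
      {q | 0 < (inner ℝ (signStep s.1 s.2.1 (signStep s.1 s.2.1 s.2.2 q.1) q.2) s.1 : ℝ)} := by
    -- Having a uniform positive lower bound passes to subsets and finite unions, so it need only
    -- hold near each point of `K`.
    refine hKc.induction_on ⟨1, one_pos, by simp⟩ ?_ ?_ ?_
    · rintro A B hAB ⟨δ, hδ, h⟩
      exact ⟨δ, hδ, fun s hs => h s (hAB hs)⟩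
    · rintro A B ⟨δ, hδ, h⟩ ⟨δ', hδ', h'⟩
      refine ⟨min δ δ', lt_min hδ hδ', ?_⟩
      rintro s (hs | hs)
      · exact (min_le_left _ _).trans (h s hs)
      · exact (min_le_right _ _).trans (h' s hs)
    · rintro ⟨x, p, z⟩ ⟨⟨hx, hp, hz⟩, hzx⟩
      simp only [S, mem_sphere_zero_iff_norm] at hx hp hz
      have hz0 : z ≠ 0 := by rintro rfl; simp at hz
      obtain ⟨y, y', hy, hy', hev⟩ := exists_two_steps_pos hN hx hp hz0 hzx
      rw [nhds_prod_eq, eventually_prod_iff] at hev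
      obtain ⟨pa, hpa, pb, hpb, hab⟩ := hev
      rw [nhds_prod_eq, eventually_prod_iff] at hpb
      obtain ⟨pc, hpc, pd, hpd, hcd⟩ := hpb
      refine ⟨{s | pa s}, mem_nhdsWithin_of_mem_nhds hpa,
        uniformSphere N {q | pc q} * uniformSphere N {q | pd q},
        ENNReal.mul_pos (uniformSphere_pos_of_mem_nhds hy hpc).ne'
          (uniformSphere_pos_of_mem_nhds hy' hpd).ne', ?_⟩
      intro s hs
      rw [← Measure.prod_prod]
      refine measure_mono ?_
      rintro ⟨q, q'⟩ ⟨hq, hq'⟩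
      exact hab hs (hcd hq hq')
  obtain ⟨δ, hδ, h⟩ := hmain
  refine ⟨δ, hδ, ?_⟩
  intro x p z hx hp hz hzx
  have hn : 0 < ‖z‖ := norm_pos_iff.2 hz
  have hn' : 0 < ‖z‖⁻¹ := inv_pos.2 hn
  have hmem : (x, p, ‖z‖⁻¹ • z) ∈ K := by
    refine ⟨⟨by simpa [S] using hx, by simpa [S] using hp, ?_⟩, ?_⟩
    · simp only [S, mem_sphere_zero_iff_norm, norm_smul, norm_inv, norm_norm]
      exact inv_mul_cancel₀ hn.ne'
    · show (inner ℝ (‖z‖⁻¹ • z) x : ℝ) ≤ 0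
      rw [real_inner_smul_left]
      exact mul_nonpos_of_nonneg_of_nonpos hn'.le hzx
  refine (h _ hmem).trans (measure_mono ?_)
  intro q hq
  rw [Set.mem_ofPred_eq] at hq ⊢
  simp only [signStep_smul hn', real_inner_smul_left] at hq
  exact (mul_pos_iff_of_pos_left hn').1 hq

end Escape

/-! ### Decay of real sequences -/

section RealSequences

/-- For `β n = γ √(a n) / 2` the hypothesis yields the logistic inequality `β (n + 1) ≤ β n (1 - β
n)`, from which `n β n ≤ 1` follows by induction. -/
lemma mul_sq_le_of_le_sub_mul_sqrt {a : ℕ → ℝ} {γ : ℝ} (hγ : 0 < γ) (ha : ∀ n, 0 ≤ a n)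
    (h : ∀ n, a (n + 1) ≤ a n - γ * (a n * √(a n))) (n : ℕ) : a n * (n : ℝ) ^ 2 ≤ 4 / γ ^ 2 := by
  have key : γ * √(a n) / 2 * n ≤ 1 := by
    induction n with
    | zero => simp
    | succ n ih =>
      set b := √(a n) with hb
      have hb0 : 0 ≤ b := Real.sqrt_nonneg _
      have hb2 : b ^ 2 = a n := Real.sq_sqrt (ha n)
      have hstep : √(a (n + 1)) ≤ b * (1 - γ * b / 2) := by
        rcases hb0.eq_or_lt with h0 | h0
        · have : a (n + 1) ≤ 0 := by
            have := h n
            rw [← hb, ← hb2, ← h0] at this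
            simpa using this
          rw [Real.sqrt_eq_zero_of_nonpos this, ← h0, zero_mul]
        · have h1 : b ^ 2 * (γ * b) ≤ b ^ 2 * 1 := by
            have h2 := h n
            have h3 := ha (n + 1)
            rw [← hb, ← hb2] at h2
            linarith
          have h4 : γ * b ≤ 1 := le_of_mul_le_mul_left h1 (by positivity)
          refine Real.sqrt_le_iff.2 ⟨mul_nonneg hb0 (by linarith), ?_⟩
          have h2 := h n
          rw [← hb, ← hb2] at h2
          nlinarith [sq_nonneg (γ * b * b)]
      set β := γ * b / 2 with hβ
      have hβ0 : 0 ≤ β := by positivity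
      have h5 : γ * √(a (n + 1)) / 2 ≤ β * (1 - β) := by
        have := mul_le_mul_of_nonneg_left hstep (show 0 ≤ γ / 2 by positivity)
        rw [hβ] at this ⊢
        linarith
      have hβ1 : 0 ≤ 1 - β ∨ β = 0 := by
        rcases hβ0.eq_or_lt with h0 | h0
        · exact Or.inr h0.symm
        · left
          have : 0 ≤ β * (1 - β) := le_trans (by positivity) h5
          exact nonneg_of_mul_nonneg_right this h0
      have h6 : γ * √(a (n + 1)) / 2 * ((n : ℝ) + 1) ≤ β * (1 - β) * ((n : ℝ) + 1) := by gcongr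
      push_cast
      refine h6.trans ?_
      rcases hβ1 with h7 | h7
      -- `β(1 - β)(n + 1) = (1 - β)(βn + β) ≤ (1 - β)(1 + β) ≤ 1`.
      · nlinarith
      · rw [h7]; simp
  have hs : √(a n) ^ 2 = a n := Real.sq_sqrt (ha n)
  rw [le_div_iff₀ (by positivity)]
  have h0 : 0 ≤ γ * √(a n) / 2 * n := by positivity
  have h1 : (γ * √(a n) / 2 * n) ^ 2 ≤ 1 := pow_le_one₀ h0 key
  rw [← hs]
  nlinarith

/-- Compare `n` with the last time `m + 2 ^ j ≤ n`: `n + 1` is at most a constant times `2 ^ j`, and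
the spare factor `(n + 1) ^ (p - q)` tends to `0`. -/
lemma tendsto_mul_rpow_of_dyadic {D : ℕ → ℝ} {m : ℕ} {M p q : ℝ} (hD0 : ∀ n, 0 ≤ D n)
    (hD : ∀ n, m ≤ n → D (n + 1) ≤ D n) (hq : 0 ≤ q) (hpq : p < q)
    (hM : ∀ j : ℕ, D (m + 2 ^ j) * ((2 : ℝ) ^ j) ^ q ≤ M) :
    Tendsto (fun n : ℕ => D n * ((n : ℝ) + 1) ^ p) atTop (𝓝 0) := by
  have hanti : ∀ n n', m ≤ n → n ≤ n' → D n' ≤ D n := by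
    intro n n' hn hnn
    induction n', hnn using Nat.le_induction with
    | base => exact le_rfl
    | succ k hk ih => exact (hD k (hn.trans hk)).trans ih
  have hM0 : 0 ≤ M := le_trans (mul_nonneg (hD0 _) (by positivity)) (hM 0)
  have hbound : ∀ n, m + 1 ≤ n → D n * ((n : ℝ) + 1) ^ p ≤
      M * (2 * ((m : ℝ) + 2)) ^ q * ((n : ℝ) + 1) ^ (p - q) := by
    intro n hn
    set j := Nat.log 2 (n - m) with hj
    have h1 : 2 ^ j ≤ n - m := Nat.pow_log_le_self 2 (by omega)
    have h2 : n - m < 2 ^ (j + 1) := Nat.lt_pow_succ_log_self (by norm_num) _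
    have h3 : D n ≤ D (m + 2 ^ j) := hanti _ _ (by omega) (by omega)
    have h4 : (n : ℝ) + 1 ≤ 2 * ((m : ℝ) + 2) * 2 ^ j := by
      have h5 : n + 1 ≤ (m + 2) * (n - m) := by
        obtain ⟨t, rfl⟩ := Nat.exists_eq_add_of_le hn
        have : m + 1 + t - m = 1 + t := by omega
        rw [this]; nlinarith
      have h6 : n + 1 ≤ 2 * (m + 2) * 2 ^ j := by
        have := Nat.mul_le_mul_left (m + 2) h2.le
        rw [pow_succ] at this
        linarith
      exact_mod_cast h6
    have hn1 : 0 < (n : ℝ) + 1 := by positivity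
    have h7 : ((n : ℝ) + 1) ^ q ≤ (2 * ((m : ℝ) + 2)) ^ q * ((2 : ℝ) ^ j) ^ q := by
      rw [← Real.mul_rpow (by positivity) (by positivity)]
      exact Real.rpow_le_rpow hn1.le h4 hq
    rw [Real.rpow_sub hn1, mul_div_assoc', le_div_iff₀ (Real.rpow_pos_of_pos hn1 _)]
    calc D n * ((n : ℝ) + 1) ^ p * ((n : ℝ) + 1) ^ q
        ≤ D (m + 2 ^ j) * ((n : ℝ) + 1) ^ p * ((2 * ((m : ℝ) + 2)) ^ q * ((2 : ℝ) ^ j) ^ q) := by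
          have := hD0 (m + 2 ^ j)
          gcongr
      _ = D (m + 2 ^ j) * ((2 : ℝ) ^ j) ^ q * ((2 * ((m : ℝ) + 2)) ^ q * ((n : ℝ) + 1) ^ p) := by
          ring
      _ ≤ M * ((2 * ((m : ℝ) + 2)) ^ q * ((n : ℝ) + 1) ^ p) := by
          gcongr
          exact hM j
      _ = M * (2 * ((m : ℝ) + 2)) ^ q * ((n : ℝ) + 1) ^ p := by ring
  have hlim : Tendsto (fun n : ℕ => M * (2 * ((m : ℝ) + 2)) ^ q * ((n : ℝ) + 1) ^ (p - q))
      atTop (𝓝 0) := by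
    have h1 : Tendsto (fun n : ℕ => (n : ℝ) + 1) atTop atTop :=
      tendsto_atTop_add_const_right _ _ tendsto_natCast_atTop_atTop
    have h2 := (tendsto_rpow_neg_atTop (show 0 < q - p by linarith)).comp h1
    have h3 := h2.const_mul (M * (2 * ((m : ℝ) + 2)) ^ q)
    simpa [Function.comp_def, neg_sub] using h3
  refine squeeze_zero' (Eventually.of_forall fun n => mul_nonneg (hD0 n) (by positivity)) ?_ hlim
  filter_upwards [eventually_ge_atTop (m + 1)] with n hn using hbound n hn

end RealSequences

/-! ### Freezing the past against an independent vector -/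

section Independence

variable {Ω T E : Type*} {m : MeasurableSpace Ω} [mΩ : MeasurableSpace Ω] [MeasurableSpace T] [MeasurableSpace E]
  {P : Measure Ω} [IsProbabilityMeasure P] {S : Ω → T} {Y : Ω → E}
  {μ : Measure E} [IsProbabilityMeasure μ] {A : Set Ω}

/-- Checked on rectangles, where `S ⁻¹' s ∩ A` belongs to the past. This replaces conditional
expectations throughout. -/
lemma map_prodMk_restrict_eq_prod (hm : m ≤ mΩ) (hS : Measurable[m] S) (hY : Measurable Y)
    (hind : Indep m (MeasurableSpace.comap Y inferInstance) P) (hlaw : P.map Y = μ)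
    (hA : MeasurableSet[m] A) :
    (P.restrict A).map (fun ω => (S ω, Y ω)) = ((P.restrict A).map S).prod μ := by
  have hS' : Measurable S := hS.mono hm le_rfl
  have : IsFiniteMeasure ((P.restrict A).map S) := Measure.isFiniteMeasure_map _ _
  refine (Measure.prod_eq fun s t hs ht => ?_).symm
  rw [Measure.map_apply (hS'.prodMk hY) (hs.prod ht), Measure.map_apply hS' hs,
    Measure.restrict_apply (hS'.prodMk hY (hs.prod ht)), Measure.restrict_apply (hS' hs), ← hlaw,
    Measure.map_apply hY ht]
  have h := (Indep_iff _ _ P).1 hind (S ⁻¹' s ∩ A) (Y ⁻¹' t) ((hS hs).inter hA) ⟨t, ht, rfl⟩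
  rw [← h]
  congr 1
  ext ω
  simp only [Set.mem_inter_iff, Set.mem_preimage, Set.mem_prod]
  tauto

/-- By Fubini: every section of the graph of `g` is a single point, hence null. -/
lemma ae_ne_of_indep [MeasurableSingletonClass E] [MeasurableEq E]
    (hm : m ≤ mΩ) (hS : Measurable[m] S) (hY : Measurable Y)
    (hind : Indep m (MeasurableSpace.comap Y inferInstance) P) (hlaw : P.map Y = μ)
    (hμ : ∀ y, μ {y} = 0) {g : T → E} (hg : Measurable g) : ∀ᵐ ω ∂P, Y ω ≠ g (S ω) := by
  have hS' : Measurable S := hS.mono hm le_rfl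
  have : IsFiniteMeasure (P.map S) := Measure.isFiniteMeasure_map _ _
  have h := map_prodMk_restrict_eq_prod (A := Set.univ) hm hS hY hind hlaw MeasurableSet.univ
  rw [Measure.restrict_univ] at h
  have hB : MeasurableSet {q : T × E | q.2 = g q.1} :=
    measurableSet_eq_fun measurable_snd (hg.comp measurable_fst)
  have h0 : (P.map S).prod μ {q : T × E | q.2 = g q.1} = 0 := by
    rw [Measure.measure_prod_null hB]
    exact Eventually.of_forall fun s => hμ (g s)
  rw [← h, Measure.map_apply (hS'.prodMk hY) hB] at h0
  rw [ae_iff]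
  simpa using h0

lemma setIntegral_eq_of_indep (hm : m ≤ mΩ) (hS : Measurable[m] S) (hY : Measurable Y)
    (hind : Indep m (MeasurableSpace.comap Y inferInstance) P) (hlaw : P.map Y = μ)
    (hA : MeasurableSet[m] A) {f : T × E → ℝ} (hf : Measurable f)
    (hint : Integrable (fun ω => f (S ω, Y ω)) (P.restrict A)) :
    ∫ ω in A, f (S ω, Y ω) ∂P = ∫ ω in A, ∫ y, f (S ω, y) ∂μ ∂P := by
  have hS' : Measurable S := hS.mono hm le_rfl
  have : IsFiniteMeasure ((P.restrict A).map S) := Measure.isFiniteMeasure_map _ _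
  have h := map_prodMk_restrict_eq_prod hm hS hY hind hlaw hA
  have hint' : Integrable f (((P.restrict A).map S).prod μ) := by
    rw [← h, integrable_map_measure hf.aestronglyMeasurable (hS'.prodMk hY).aemeasurable]
    exact hint
  rw [← integral_map (f := f) (hS'.prodMk hY).aemeasurable hf.aestronglyMeasurable, h,
    integral_prod _ hint', integral_map hS'.aemeasurable]
  exact hf.stronglyMeasurable.integral_prod_right'.aestronglyMeasurable

end Independence

/-! ### The Markov chain of estimates -/

/-- A random sequence of states `(x, p, z)` in which `x` and `p` are constant and `z` follows the
recursion `signStep` driven by independent uniform frame vectors. -/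
structure IsSignChain {N : ℕ} {Ω : Type*} [mΩ : MeasurableSpace Ω] (P : Measure Ω)
    (ℱ : Filtration ℕ mΩ)
    (S : ℕ → Ω → EuclideanSpace ℝ (Fin N) × EuclideanSpace ℝ (Fin N) × EuclideanSpace ℝ (Fin N))
    (Y : ℕ → Ω → EuclideanSpace ℝ (Fin N)) : Prop where
  measurable_zero : Measurable[ℱ 0] (S 0)
  measurable_frame : ∀ n, Measurable[ℱ (n + 1)] (Y n)
  indep : ∀ n, Indep (ℱ n) (MeasurableSpace.comap (Y n) inferInstance) P
  law : ∀ n, P.map (Y n) = uniformSphere N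
  step : ∀ n ω, S (n + 1) ω =
    ((S n ω).1, (S n ω).2.1, signStep (S n ω).1 (S n ω).2.1 (S n ω).2.2 (Y n ω))
  norm_eq_one : ∀ᵐ ω ∂P, ‖(S 0 ω).1‖ = 1 ∧ ‖(S 0 ω).2.1‖ = 1 ∧ ‖(S 0 ω).2.2‖ = 1

namespace IsSignChain

variable {N : ℕ} {Ω : Type*} [mΩ : MeasurableSpace Ω] {P : Measure Ω}
  {ℱ : Filtration ℕ mΩ}
  {S : ℕ → Ω → EuclideanSpace ℝ (Fin N) × EuclideanSpace ℝ (Fin N) × EuclideanSpace ℝ (Fin N)}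
  {Y : ℕ → Ω → EuclideanSpace ℝ (Fin N)}

lemma measurable (h : IsSignChain P ℱ S Y) (n : ℕ) : Measurable[ℱ n] (S n) := by
  induction n with
  | zero => exact h.measurable_zero
  | succ n ih =>
    have e : S (n + 1) = fun ω => ((S n ω).1, (S n ω).2.1,
        signStep (S n ω).1 (S n ω).2.1 (S n ω).2.2 (Y n ω)) := funext (h.step n)
    rw [e]
    have hS : Measurable[ℱ (n + 1)] (S n) := ih.mono (ℱ.mono n.le_succ) le_rfl
    exact (measurable_fst.comp hS).prodMk (((measurable_fst.comp measurable_snd).comp hS).prodMk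
      (@measurable_signStep N Ω (ℱ (n + 1)) _ _ _ _ (measurable_fst.comp hS)
        ((measurable_fst.comp measurable_snd).comp hS)
        ((measurable_snd.comp measurable_snd).comp hS) (h.measurable_frame n)))

lemma measurable_ambient (h : IsSignChain P ℱ S Y) (n : ℕ) : Measurable (S n) :=
  (h.measurable n).mono (ℱ.le n) le_rfl

lemma measurable_frame_ambient (h : IsSignChain P ℱ S Y) (n : ℕ) : Measurable (Y n) :=
  (h.measurable_frame n).mono (ℱ.le _) le_rfl

lemma target_eq (h : IsSignChain P ℱ S Y) (n : ℕ) (ω : Ω) : (S n ω).1 = (S 0 ω).1 := by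
  induction n with
  | zero => rfl
  | succ n ih => rw [h.step, ih]

lemma reference_eq (h : IsSignChain P ℱ S Y) (n : ℕ) (ω : Ω) : (S n ω).2.1 = (S 0 ω).2.1 := by
  induction n with
  | zero => rfl
  | succ n ih => rw [h.step, ih]

lemma estimate_succ (h : IsSignChain P ℱ S Y) (n : ℕ) (ω : Ω) : (S (n + 1) ω).2.2 =
    signStep (S 0 ω).1 (S 0 ω).2.1 (S n ω).2.2 (Y n ω) := by
  rw [h.step, h.target_eq, h.reference_eq]

lemma norm_estimate_le (h : IsSignChain P ℱ S Y) {ω : Ω} (hω : ‖(S 0 ω).2.2‖ = 1) (n : ℕ) :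
    ‖(S n ω).2.2‖ ≤ 1 := by
  induction n with
  | zero => exact hω.le
  | succ n ih => rw [h.estimate_succ]; exact (norm_signStep_le _ _ _ _).trans ih

lemma inner_mono (h : IsSignChain P ℱ S Y) (ω : Ω) :
    Monotone fun n => (inner ℝ (S n ω).2.2 (S 0 ω).1 : ℝ) := by
  refine monotone_nat_of_le_succ fun n => ?_
  rw [h.estimate_succ]
  exact inner_le_inner_signStep _ _ _ _

variable [IsProbabilityMeasure P]

/-- Only one value of the new vector, determined by the past, can annihilate the estimate, and
single points are null. -/
lemma ae_estimate_ne_zero (hN : 2 ≤ N) (h : IsSignChain P ℱ S Y) (n : ℕ) :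
    ∀ᵐ ω ∂P, (S n ω).2.2 ≠ 0 := by
  have := isProbabilityMeasure_uniformSphere hN
  induction n with
  | zero =>
    filter_upwards [h.norm_eq_one] with ω hω h0
    rw [h0, norm_zero] at hω
    exact zero_ne_one hω.2.2
  | succ n ih =>
    have hg : Measurable fun s : EuclideanSpace ℝ (Fin N) × EuclideanSpace ℝ (Fin N) ×
        EuclideanSpace ℝ (Fin N) =>
        s.2.1 - (2 * (inner ℝ s.2.2 s.2.1 : ℝ) / ‖s.2.2‖ ^ 2) • s.2.2 := by fun_prop
    have hY : ∀ᵐ ω ∂P, ‖Y n ω‖ = 1 :=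
      ae_of_ae_map (h.measurable_frame_ambient n).aemeasurable
        (by rw [h.law n]; exact ae_norm_eq_one_uniformSphere)
    filter_upwards [ih, h.norm_eq_one, hY, ae_ne_of_indep (ℱ.le n) (h.measurable n)
      (h.measurable_frame_ambient n) (h.indep n) (h.law n) (uniformSphere_singleton hN) hg]
      with ω hz hω hy hne h0
    rw [h.estimate_succ] at h0
    refine hne ?_
    rw [h.reference_eq]
    exact eq_of_signStep_eq_zero hω.2.1 hy hz h0

lemma map_two_steps (hN : 2 ≤ N) (h : IsSignChain P ℱ S Y) (n : ℕ) {A : Set Ω}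
    (hA : MeasurableSet[ℱ n] A) :
    (P.restrict A).map (fun ω => (S n ω, Y n ω, Y (n + 1) ω)) =
      ((P.restrict A).map (S n)).prod ((uniformSphere N).prod (uniformSphere N)) := by
  have := isProbabilityMeasure_uniformSphere hN
  have : IsFiniteMeasure ((P.restrict A).map (S n)) := Measure.isFiniteMeasure_map _ _
  have h1 := map_prodMk_restrict_eq_prod (ℱ.le n) (h.measurable n) (h.measurable_frame_ambient n)
    (h.indep n) (h.law n) hA
  have hS : Measurable[ℱ (n + 1)] (S n) := (h.measurable n).mono (ℱ.mono n.le_succ) le_rfl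
  have h2 := map_prodMk_restrict_eq_prod (ℱ.le (n + 1)) (hS.prodMk (h.measurable_frame n))
    (h.measurable_frame_ambient (n + 1)) (h.indep (n + 1)) (h.law (n + 1))
    (ℱ.mono n.le_succ _ hA)
  rw [h1] at h2
  rw [← Measure.prodAssoc_prod, ← h2, Measure.map_map (MeasurableEquiv.measurable _)
    (((h.measurable_ambient n).prodMk (h.measurable_frame_ambient n)).prodMk
      (h.measurable_frame_ambient (n + 1)))]
  rfl

/-- The event `A n` of being in the wrong half-space shrinks by a proportion of at least `δ` every
two steps. If the intersection had positive probability, each pair of steps would remove a fixed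
mass, eventually more than `1` in total. -/
lemma ae_exists_inner_pos (hN : 2 ≤ N) (h : IsSignChain P ℱ S Y) :
    ∀ᵐ ω ∂P, ∃ m, 0 < (inner ℝ (S m ω).2.2 (S 0 ω).1 : ℝ) := by
  have := isProbabilityMeasure_uniformSphere hN
  obtain ⟨δ, hδ, hδ'⟩ := exists_le_prod_two_steps_pos hN
  set B : Set (EuclideanSpace ℝ (Fin N) × EuclideanSpace ℝ (Fin N) × EuclideanSpace ℝ (Fin N)) :=
    {s | (inner ℝ s.2.2 s.1 : ℝ) ≤ 0} with hB
  have hBm : MeasurableSet B := measurableSet_le (by fun_prop) measurable_const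
  set A : ℕ → Set Ω := fun n => S n ⁻¹' B with hAdef
  have hA : ∀ n, MeasurableSet[ℱ n] (A n) := fun n => h.measurable n hBm
  have hA' : ∀ n, MeasurableSet (A n) := fun n => h.measurable_ambient n hBm
  have hmem : ∀ n ω, ω ∈ A n ↔ (inner ℝ (S n ω).2.2 (S 0 ω).1 : ℝ) ≤ 0 := by
    intro n ω
    rw [hAdef, hB, Set.mem_preimage, Set.mem_ofPred_eq, h.target_eq]
  have hanti : ∀ n, A (n + 2) ⊆ A n := by
    intro n ω hω
    rw [hmem] at hω ⊢
    exact (h.inner_mono ω (by omega)).trans hω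
  set F : (EuclideanSpace ℝ (Fin N) × EuclideanSpace ℝ (Fin N) × EuclideanSpace ℝ (Fin N)) ×
      EuclideanSpace ℝ (Fin N) × EuclideanSpace ℝ (Fin N) → ℝ := fun q =>
    (inner ℝ (signStep q.1.1 q.1.2.1 (signStep q.1.1 q.1.2.1 q.1.2.2 q.2.1) q.2.2) q.1.1 : ℝ)
    with hF
  have hFm : Measurable F := by
    refine Measurable.inner ?_ (by fun_prop)
    exact measurable_signStep (by fun_prop) (by fun_prop)
      (measurable_signStep (by fun_prop) (by fun_prop) (by fun_prop) (by fun_prop)) (by fun_prop)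
  have hF2 : ∀ n ω, F (S n ω, Y n ω, Y (n + 1) ω) = inner ℝ (S (n + 2) ω).2.2 (S 0 ω).1 := by
    intro n ω
    rw [h.estimate_succ (n + 1), h.estimate_succ n]
    simp only [hF, h.target_eq n, h.reference_eq n]
  have hrec : ∀ n, P (A (n + 2)) + δ * P (A n) ≤ P (A n) := by
    intro n
    have hpos : MeasurableSet {q | 0 < F q} := measurableSet_lt measurable_const hFm
    have hS3 : Measurable fun ω => (S n ω, Y n ω, Y (n + 1) ω) :=
      (h.measurable_ambient n).prodMk
        ((h.measurable_frame_ambient n).prodMk (h.measurable_frame_ambient (n + 1)))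
    have e1 : P (A n \ A (n + 2)) = (P.restrict (A n)).map
        (fun ω => (S n ω, Y n ω, Y (n + 1) ω)) {q | 0 < F q} := by
      rw [Measure.map_apply hS3 hpos, Measure.restrict_apply (hS3 hpos)]
      congr 1
      ext ω
      simp only [Set.mem_sdiff, Set.mem_inter_iff, Set.mem_preimage, Set.mem_ofPred_eq, hF2,
        hmem, not_le]
      tauto
    have e2 : δ * P (A n) ≤ P (A n \ A (n + 2)) := by
      rw [e1, h.map_two_steps hN n (hA n), Measure.prod_apply hpos,
        lintegral_map (measurable_measure_prodMk_left hpos) (h.measurable_ambient n),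
        ← Measure.restrict_apply_univ (A n), ← lintegral_const]
      refine lintegral_mono_ae ?_
      filter_upwards [ae_restrict_mem (hA' n), ae_restrict_of_ae h.norm_eq_one,
        ae_restrict_of_ae (h.ae_estimate_ne_zero hN n)] with ω hω hn hz
      have hx : ‖(S n ω).1‖ = 1 := by rw [h.target_eq]; exact hn.1
      have hp : ‖(S n ω).2.1‖ = 1 := by rw [h.reference_eq]; exact hn.2.1
      have hi : (inner ℝ (S n ω).2.2 (S n ω).1 : ℝ) ≤ 0 := hω
      have := hδ' (S n ω).1 (S n ω).2.1 (S n ω).2.2 hx hp hz hi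
      exact this
    calc P (A (n + 2)) + δ * P (A n) ≤ P (A (n + 2)) + P (A n \ A (n + 2)) := by gcongr
      _ = P (A n) := by
        rw [measure_sdiff (hanti n) (hA' (n + 2)).nullMeasurableSet (measure_ne_top _ _)]
        exact add_tsub_cancel_of_le (measure_mono (hanti n))
  have hle : ∀ n : ℕ, P (A (2 * n)) + n * (δ * P (⋂ k, A k)) ≤ 1 := by
    intro n
    induction n with
    | zero => simpa using prob_le_one
    | succ n ih =>
      refine le_trans ?_ ih
      have h1 : P (⋂ k, A k) ≤ P (A (2 * n)) := measure_mono (Set.iInter_subset _ _)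
      calc P (A (2 * (n + 1))) + ((n + 1 : ℕ) : ENNReal) * (δ * P (⋂ k, A k))
          = P (A (2 * n + 2)) + δ * P (⋂ k, A k) + n * (δ * P (⋂ k, A k)) := by
            push_cast; ring_nf
        _ ≤ P (A (2 * n + 2)) + δ * P (A (2 * n)) + n * (δ * P (⋂ k, A k)) := by gcongr
        _ ≤ _ := by gcongr; exact hrec _
  have hzero : P (⋂ k, A k) = 0 := by
    by_contra hne
    have hc : δ * P (⋂ k, A k) ≠ 0 := mul_ne_zero hδ.ne' hne
    obtain ⟨n, hn⟩ := ENNReal.exists_nat_mul_gt hc ENNReal.one_ne_top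
    exact absurd (le_add_self.trans (hle n)) (not_le.2 hn)
  have hae := measure_eq_zero_iff_ae_notMem.1 hzero
  filter_upwards [hae] with ω hω
  simp only [Set.mem_iInter, not_forall, hmem, not_le] at hω
  exact hω

end IsSignChain

/-- The tangent to the convex function `D ^ (3/2)` at `s²`; with `t = √D` the gap is `(t - s)²(2t +
s) / 2`. It serves as Jensen's inequality. -/
lemma tangent_le_mul_sqrt {D s : ℝ} (hD : 0 ≤ D) (hs : 0 ≤ s) :
    3 / 2 * s * D - s ^ 3 / 2 ≤ D * √D := by
  have h2 : √D ^ 2 = D := Real.sq_sqrt hD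
  set t := √D
  have ht : 0 ≤ t := Real.sqrt_nonneg _
  rw [← h2]
  nlinarith [mul_nonneg (sq_nonneg (t - s)) (show 0 ≤ 2 * t + s by linarith)]

namespace IsSignChain

variable {N : ℕ} {Ω : Type*} [mΩ : MeasurableSpace Ω] {P : Measure Ω} [IsProbabilityMeasure P]
  {ℱ : Filtration ℕ mΩ}
  {S : ℕ → Ω → EuclideanSpace ℝ (Fin N) × EuclideanSpace ℝ (Fin N) × EuclideanSpace ℝ (Fin N)}
  {Y : ℕ → Ω → EuclideanSpace ℝ (Fin N)}

lemma setIntegral_sqDistLine_succ_le (hN : 2 ≤ N) (h : IsSignChain P ℱ S Y) {r γ : ℝ}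
    (hγ : 0 ≤ γ) (hstep : ∀ x p z : EuclideanSpace ℝ (Fin N), ‖x‖ = 1 → ‖p‖ = 1 → ‖z‖ ≤ 1 →
      0 ≤ (inner ℝ z x : ℝ) → r ^ 2 ≤ 1 - (inner ℝ x p : ℝ) ^ 2 →
      ∫ y, sqDistLine x (signStep x p z y) ∂uniformSphere N ≤
        sqDistLine x z - γ * (sqDistLine x z * √(sqDistLine x z)))
    {n : ℕ} {A : Set Ω} (hA : MeasurableSet[ℱ n] A)
    (hpos : ∀ ω ∈ A, 0 ≤ (inner ℝ (S n ω).2.2 (S 0 ω).1 : ℝ))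
    (hr : ∀ ω ∈ A, r ^ 2 ≤ 1 - (inner ℝ (S 0 ω).1 (S 0 ω).2.1 : ℝ) ^ 2) :
    ∫ ω in A, sqDistLine (S (n + 1) ω).1 (S (n + 1) ω).2.2 ∂P ≤
      (∫ ω in A, sqDistLine (S n ω).1 (S n ω).2.2 ∂P) -
        γ * ((∫ ω in A, sqDistLine (S n ω).1 (S n ω).2.2 ∂P) *
          √(∫ ω in A, sqDistLine (S n ω).1 (S n ω).2.2 ∂P)) := by
  have := isProbabilityMeasure_uniformSphere hN
  have hA' : MeasurableSet A := ℱ.le n _ hA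
  have hbd : ∀ k, ∀ᵐ ω ∂P.restrict A, 0 ≤ sqDistLine (S k ω).1 (S k ω).2.2 ∧
      sqDistLine (S k ω).1 (S k ω).2.2 ≤ 1 := by
    intro k
    filter_upwards [ae_restrict_of_ae h.norm_eq_one] with ω hω
    refine ⟨sqDistLine_nonneg (by rw [h.target_eq]; exact hω.1), sqDistLine_le.trans ?_⟩
    exact pow_le_one₀ (norm_nonneg _) (h.norm_estimate_le hω.2.2 k)
  have hmeas : ∀ k, Measurable fun ω => sqDistLine (S k ω).1 (S k ω).2.2 := fun k =>
    measurable_sqDistLine (measurable_fst.comp (h.measurable_ambient k))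
      ((measurable_snd.comp measurable_snd).comp (h.measurable_ambient k))
  have hint : ∀ k, Integrable (fun ω => sqDistLine (S k ω).1 (S k ω).2.2) (P.restrict A) := by
    intro k
    refine Integrable.of_bound (C := 1) (hmeas k).aestronglyMeasurable ?_
    filter_upwards [hbd k] with ω hω
    rw [Real.norm_eq_abs, abs_of_nonneg hω.1]
    exact hω.2
  have hint' : Integrable (fun ω => sqDistLine (S n ω).1 (S n ω).2.2 *
      √(sqDistLine (S n ω).1 (S n ω).2.2)) (P.restrict A) := by
    refine Integrable.of_bound (C := 1) ((hmeas n).mul (hmeas n).sqrt).aestronglyMeasurable ?_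
    filter_upwards [hbd n] with ω hω
    rw [Real.norm_eq_abs, abs_of_nonneg (mul_nonneg hω.1 (Real.sqrt_nonneg _))]
    exact mul_le_one₀ hω.2 (Real.sqrt_nonneg _) (Real.sqrt_le_one.2 hω.2)
  set a := ∫ ω in A, sqDistLine (S n ω).1 (S n ω).2.2 ∂P with ha
  have ha0 : 0 ≤ a := integral_nonneg_of_ae ((hbd n).mono fun ω hω => hω.1)
  have htan : a * √a ≤ ∫ ω in A, sqDistLine (S n ω).1 (S n ω).2.2 *
      √(sqDistLine (S n ω).1 (S n ω).2.2) ∂P := by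
    have h1 : ∫ ω in A, (3 / 2 * √a * sqDistLine (S n ω).1 (S n ω).2.2 - √a ^ 3 / 2) ∂P ≤
        ∫ ω in A, sqDistLine (S n ω).1 (S n ω).2.2 *
          √(sqDistLine (S n ω).1 (S n ω).2.2) ∂P :=
      integral_mono_ae (((hint n).const_mul _).sub (integrable_const _)) hint'
        ((hbd n).mono fun ω hω => tangent_le_mul_sqrt hω.1 (Real.sqrt_nonneg _))
    rw [integral_sub ((hint n).const_mul _) (integrable_const _), integral_const_mul, ← ha,
      integral_const, smul_eq_mul, measureReal_restrict_apply_univ] at h1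
    refine le_trans ?_ h1
    -- The restricted measure has mass at most `1`, so the constant term costs at most half of `a
    -- √a`, leaving `3/2 - 1/2 = 1`.
    have h2 : P.real A * (√a ^ 3 / 2) ≤ 1 * (√a ^ 3 / 2) := by
      gcongr
      exact measureReal_le_one
    have h3 : √a ^ 2 = a := Real.sq_sqrt ha0
    have h4 : √a ^ 3 = a * √a := by rw [pow_succ, h3]
    rw [h4] at h2 ⊢
    linarith
  have hf : Measurable fun q : (EuclideanSpace ℝ (Fin N) × EuclideanSpace ℝ (Fin N) ×
      EuclideanSpace ℝ (Fin N)) × EuclideanSpace ℝ (Fin N) =>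
      sqDistLine q.1.1 (signStep q.1.1 q.1.2.1 q.1.2.2 q.2) :=
    measurable_sqDistLine (by fun_prop)
      (measurable_signStep (by fun_prop) (by fun_prop) (by fun_prop) (by fun_prop))
  have hS1 : ∀ ω, sqDistLine (S (n + 1) ω).1 (S (n + 1) ω).2.2 =
      sqDistLine (S n ω).1 (signStep (S n ω).1 (S n ω).2.1 (S n ω).2.2 (Y n ω)) := fun ω => by
    rw [h.step]
  have hint1 := hint (n + 1)
  simp only [hS1] at hint1 ⊢
  rw [setIntegral_eq_of_indep (ℱ.le n) (h.measurable n) (h.measurable_frame_ambient n)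
    (h.indep n) (h.law n) hA hf hint1]
  calc ∫ ω in A, ∫ y, sqDistLine (S n ω).1 (signStep (S n ω).1 (S n ω).2.1 (S n ω).2.2 y)
        ∂uniformSphere N ∂P
      ≤ ∫ ω in A, (sqDistLine (S n ω).1 (S n ω).2.2 - γ * (sqDistLine (S n ω).1 (S n ω).2.2 *
          √(sqDistLine (S n ω).1 (S n ω).2.2))) ∂P := by
        refine integral_mono_of_nonneg ?_ ((hint n).sub (hint'.const_mul γ)) ?_
        · filter_upwards [ae_restrict_of_ae h.norm_eq_one] with ω hω
          refine integral_nonneg fun y => sqDistLine_nonneg ?_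
          rw [h.target_eq]; exact hω.1
        · filter_upwards [ae_restrict_mem hA', ae_restrict_of_ae h.norm_eq_one] with ω hωA hω
          refine hstep _ _ _ ?_ ?_ (h.norm_estimate_le hω.2.2 n) ?_ ?_
          · rw [h.target_eq]; exact hω.1
          · rw [h.reference_eq]; exact hω.2.1
          · rw [h.target_eq]; exact hpos ω hωA
          · rw [h.target_eq, h.reference_eq]; exact hr ω hωA
    _ = a - γ * ∫ ω in A, sqDistLine (S n ω).1 (S n ω).2.2 *
          √(sqDistLine (S n ω).1 (S n ω).2.2) ∂P := by
        rw [integral_sub (hint n) (hint'.const_mul γ), integral_const_mul]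
    _ ≤ a - γ * (a * √a) := by gcongr

/-- The integrals at times `m + 2 ^ j` are `O(4^(-j))`, so with weights `2^(jq)` they are dominated
by a geometric series. The random series is then almost surely finite on the event, and its sum
bounds every term. -/
lemma ae_bounded_dyadic (hN : 2 ≤ N) (h : IsSignChain P ℱ S Y) (m : ℕ) {r : ℝ} (hr0 : 0 < r)
    (hr1 : r ≤ 1) {q : ℝ} (hq : q < 2) :
    ∀ᵐ ω ∂P, 0 < (inner ℝ (S m ω).2.2 (S 0 ω).1 : ℝ) →
      r ^ 2 ≤ 1 - (inner ℝ (S 0 ω).1 (S 0 ω).2.1 : ℝ) ^ 2 →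
      ∃ M, ∀ j : ℕ, sqDistLine (S 0 ω).1 (S (m + 2 ^ j) ω).2.2 * ((2 : ℝ) ^ j) ^ q ≤ M := by
  obtain ⟨γ, hγ, hstep⟩ := exists_integral_sqDistLine_signStep_le hN hr0 hr1
  set B : Set (EuclideanSpace ℝ (Fin N) × EuclideanSpace ℝ (Fin N) × EuclideanSpace ℝ (Fin N)) :=
    {s | 0 < (inner ℝ s.2.2 s.1 : ℝ)} ∩ {s | r ^ 2 ≤ 1 - (inner ℝ s.1 s.2.1 : ℝ) ^ 2} with hB
  have hm1 : Measurable fun s : EuclideanSpace ℝ (Fin N) × EuclideanSpace ℝ (Fin N) ×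
    EuclideanSpace ℝ (Fin N) => (inner ℝ s.2.2 s.1 : ℝ) := by fun_prop
  have hm2 : Measurable fun s : EuclideanSpace ℝ (Fin N) × EuclideanSpace ℝ (Fin N) ×
    EuclideanSpace ℝ (Fin N) => 1 - (inner ℝ s.1 s.2.1 : ℝ) ^ 2 := by fun_prop
  have hBm : MeasurableSet B :=
    (measurableSet_lt measurable_const hm1).inter (measurableSet_le measurable_const hm2)
  set A : Set Ω := S m ⁻¹' B with hAdef
  have hA : MeasurableSet[ℱ m] A := h.measurable m hBm
  have hA' : MeasurableSet A := ℱ.le m _ hA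
  have hmem : ∀ ω, ω ∈ A ↔ 0 < (inner ℝ (S m ω).2.2 (S 0 ω).1 : ℝ) ∧
      r ^ 2 ≤ 1 - (inner ℝ (S 0 ω).1 (S 0 ω).2.1 : ℝ) ^ 2 := by
    intro ω
    rw [hAdef, hB, Set.mem_preimage, Set.mem_inter_iff, Set.mem_ofPred_eq, Set.mem_ofPred_eq,
      h.target_eq, h.reference_eq]
  set a : ℕ → ℝ := fun k => ∫ ω in A, sqDistLine (S (m + k) ω).1 (S (m + k) ω).2.2 ∂P with ha
  have hbd : ∀ k, ∀ᵐ ω ∂P.restrict A, 0 ≤ sqDistLine (S k ω).1 (S k ω).2.2 ∧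
      sqDistLine (S k ω).1 (S k ω).2.2 ≤ 1 := by
    intro k
    filter_upwards [ae_restrict_of_ae h.norm_eq_one] with ω hω
    refine ⟨sqDistLine_nonneg (by rw [h.target_eq]; exact hω.1), sqDistLine_le.trans ?_⟩
    exact pow_le_one₀ (norm_nonneg _) (h.norm_estimate_le hω.2.2 k)
  have hmeas : ∀ k, Measurable fun ω => sqDistLine (S k ω).1 (S k ω).2.2 := fun k =>
    measurable_sqDistLine (measurable_fst.comp (h.measurable_ambient k))
      ((measurable_snd.comp measurable_snd).comp (h.measurable_ambient k))
  have hint : ∀ k, Integrable (fun ω => sqDistLine (S k ω).1 (S k ω).2.2) (P.restrict A) := by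
    intro k
    refine Integrable.of_bound (C := 1) (hmeas k).aestronglyMeasurable ?_
    filter_upwards [hbd k] with ω hω
    rw [Real.norm_eq_abs, abs_of_nonneg hω.1]
    exact hω.2
  have ha0 : ∀ k, 0 ≤ a k := fun k => integral_nonneg_of_ae ((hbd _).mono fun ω hω => hω.1)
  have harec : ∀ k, a (k + 1) ≤ a k - γ * (a k * √(a k)) := by
    intro k
    refine h.setIntegral_sqDistLine_succ_le hN (n := m + k) hγ.le hstep
      (ℱ.mono (Nat.le_add_right m k) _ hA) ?_ ?_
    · intro ω hω
      exact ((hmem ω).1 hω).1.le.trans (h.inner_mono ω (Nat.le_add_right m k))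
    · intro ω hω
      exact ((hmem ω).1 hω).2
  have hale : ∀ j : ℕ, a (2 ^ j) * ((2 : ℝ) ^ j) ^ q ≤ 4 / γ ^ 2 * ((2 : ℝ) ^ (q - 2)) ^ j := by
    intro j
    have h1 := mul_sq_le_of_le_sub_mul_sqrt hγ ha0 harec (2 ^ j)
    push_cast at h1
    have h2 : ((2 : ℝ) ^ (q - 2)) ^ j * ((2 : ℝ) ^ j) ^ 2 = ((2 : ℝ) ^ j) ^ q := by
      rw [← Real.rpow_natCast ((2 : ℝ) ^ (q - 2)) j, ← Real.rpow_mul (by norm_num),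
        ← Real.rpow_natCast (2 : ℝ) j, ← Real.rpow_mul (by norm_num), ← Real.rpow_natCast _ 2,
        ← Real.rpow_mul (by norm_num), ← Real.rpow_add (by norm_num)]
      congr 1; push_cast; ring
    rw [← h2]
    calc a (2 ^ j) * (((2 : ℝ) ^ (q - 2)) ^ j * ((2 : ℝ) ^ j) ^ 2)
        = a (2 ^ j) * ((2 : ℝ) ^ j) ^ 2 * ((2 : ℝ) ^ (q - 2)) ^ j := by ring
      _ ≤ _ := by gcongr
  set G : ℕ → Ω → ENNReal := fun j ω =>
    ENNReal.ofReal (sqDistLine (S (m + 2 ^ j) ω).1 (S (m + 2 ^ j) ω).2.2 * ((2 : ℝ) ^ j) ^ q)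
    with hG
  have hGm : ∀ j, Measurable (G j) := fun j => ((hmeas _).mul_const _).ennreal_ofReal
  have hGint : ∀ j, ∫⁻ ω in A, G j ω ∂P ≤
      ENNReal.ofReal (4 / γ ^ 2 * ((2 : ℝ) ^ (q - 2)) ^ j) := by
    intro j
    rw [hG, ← ofReal_integral_eq_lintegral_ofReal ((hint _).mul_const _)
      ((hbd _).mono fun ω hω => mul_nonneg hω.1 (by positivity)), integral_mul_const]
    exact ENNReal.ofReal_le_ofReal (hale j)
  have hsum : ∫⁻ ω in A, ∑' j, G j ω ∂P ≠ ⊤ := by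
    rw [lintegral_tsum fun j => (hGm j).aemeasurable]
    refine ne_top_of_le_ne_top ?_ (ENNReal.tsum_le_tsum hGint)
    have hs : Summable fun j : ℕ => 4 / γ ^ 2 * ((2 : ℝ) ^ (q - 2)) ^ j := by
      refine (summable_geometric_of_lt_one (by positivity) ?_).mul_left _
      exact Real.rpow_lt_one_of_one_lt_of_neg (by norm_num) (by linarith)
    exact hs.tsum_ofReal_ne_top
  have hfin := ae_lt_top (Measurable.tsum hGm) hsum
  rw [ae_restrict_iff' hA'] at hfin
  filter_upwards [hfin] with ω hω h1 h2
  have hlt := hω ((hmem ω).2 ⟨h1, h2⟩)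
  refine ⟨(∑' j, G j ω).toReal, fun j => ?_⟩
  have hj : G j ω ≤ ∑' j, G j ω := ENNReal.le_tsum j
  have := (ENNReal.ofReal_le_iff_le_toReal hlt.ne).1 hj
  rwa [h.target_eq] at this

/-- Almost surely the squared error of the normalized estimates is `o(n ^ (-p))` for `p < 2`. -/
theorem ae_tendsto (hN : 2 ≤ N) (h : IsSignChain P ℱ S Y)
    (hxp : ∀ᵐ ω ∂P, (inner ℝ (S 0 ω).1 (S 0 ω).2.1 : ℝ) ^ 2 < 1) {p : ℝ} (hp : p < 2) :
    ∀ᵐ ω ∂P, Tendsto (fun n : ℕ => ‖(S 0 ω).1 - ‖(S n ω).2.2‖⁻¹ • (S n ω).2.2‖ ^ 2 *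
      ((n : ℝ) + 1) ^ p) atTop (𝓝 0) := by
  -- Boundedness at an exponent `q` strictly above `p` gives convergence to `0` at `p`; `q ≥ 0`
  -- keeps the power monotone.
  obtain ⟨q, hq1, hq2⟩ := exists_between (max_lt hp (zero_lt_two (α := ℝ)))
  have hpq : p < q := (le_max_left _ _).trans_lt hq1
  have hq0 : 0 ≤ q := (le_max_right _ _).trans hq1.le
  have hdy : ∀ᵐ ω ∂P, ∀ m i : ℕ, 0 < (inner ℝ (S m ω).2.2 (S 0 ω).1 : ℝ) →
      (1 / ((i : ℝ) + 1)) ^ 2 ≤ 1 - (inner ℝ (S 0 ω).1 (S 0 ω).2.1 : ℝ) ^ 2 →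
      ∃ M, ∀ j : ℕ, sqDistLine (S 0 ω).1 (S (m + 2 ^ j) ω).2.2 * ((2 : ℝ) ^ j) ^ q ≤ M := by
    rw [ae_all_iff]
    intro m
    rw [ae_all_iff]
    intro i
    refine h.ae_bounded_dyadic hN m (by positivity) ?_ hq2
    rw [div_le_one (by positivity)]
    have : (0 : ℝ) ≤ i := by positivity
    linarith
  filter_upwards [hdy, hxp, h.norm_eq_one, h.ae_exists_inner_pos hN] with ω hω hx hn ⟨m, hm⟩
  obtain ⟨i, hi⟩ := exists_nat_one_div_lt (sub_pos.2 hx)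
  have hi1 : 1 / ((i : ℝ) + 1) ≤ 1 := by
    rw [div_le_one (by positivity)]
    have : (0 : ℝ) ≤ i := by positivity
    linarith
  have hi0 : 0 ≤ 1 / ((i : ℝ) + 1) := by positivity
  -- `(1 / (i + 1))² ≤ 1 / (i + 1) < 1 - ⟨x, p⟩²`.
  obtain ⟨M, hM⟩ := hω m i hm ((by nlinarith : (1 / ((i : ℝ) + 1)) ^ 2 ≤ _).trans hi.le)
  set b := (inner ℝ (S m ω).2.2 (S 0 ω).1 : ℝ) with hb
  have hlim := tendsto_mul_rpow_of_dyadic (D := fun n => sqDistLine (S 0 ω).1 (S n ω).2.2)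
    (fun n => sqDistLine_nonneg hn.1) (fun n hmn => by
      simp only [h.estimate_succ]
      exact sqDistLine_signStep_le (hm.le.trans (h.inner_mono ω hmn))) hq0 hpq hM
  have hlim2 := hlim.const_mul (2 / b ^ 2)
  rw [mul_zero] at hlim2
  refine squeeze_zero' (Eventually.of_forall fun n => by positivity) ?_ hlim2
  filter_upwards [eventually_ge_atTop m] with n hmn
  have hmono : b ≤ (inner ℝ (S n ω).2.2 (S 0 ω).1 : ℝ) := h.inner_mono ω hmn
  have h1 := sq_norm_sub_normalize_le hn.1 (hm.trans_le hmono)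
  have hD0 := sqDistLine_nonneg (z := (S n ω).2.2) hn.1
  have h2 : 2 * sqDistLine (S 0 ω).1 (S n ω).2.2 / (inner ℝ (S n ω).2.2 (S 0 ω).1 : ℝ) ^ 2 ≤
      2 * sqDistLine (S 0 ω).1 (S n ω).2.2 / b ^ 2 := by gcongr
  calc _ ≤ 2 * sqDistLine (S 0 ω).1 (S n ω).2.2 / b ^ 2 * ((n : ℝ) + 1) ^ p := by
        gcongr
        exact h1.trans h2
    _ = _ := by ring

end IsSignChain

/-! ### From the algorithm to the chain -/

section Reduction

/-- The indices of the two initial vectors and of the first `n + 1` frame vectors. -/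
def pastIndices (n : ℕ) : Set (Fin 2 ⊕ ℕ+) :=
  {i | ∀ k : ℕ+, i = Sum.inr k → (k : ℕ) ≤ n + 1}

/-- The filtration generated by the two initial vectors and the frame vectors, the first frame
vector being known at time zero. -/
def frameFiltration {N : ℕ} {Ω : Type*} [mΩ : MeasurableSpace Ω]
    (f : Fin 2 ⊕ ℕ+ → Ω → EuclideanSpace ℝ (Fin N)) (hf : ∀ i, Measurable (f i)) :
    Filtration ℕ mΩ where
  seq n := ⨆ i ∈ pastIndices n, MeasurableSpace.comap (f i) inferInstance
  mono' _ _ hab := biSup_mono fun _ hi k hk => (hi k hk).trans (by gcongr)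
  le' _ := iSup₂_le fun i _ => (hf i).comap_le

variable {N : ℕ}

/-- The sequence of states driven by a family of frame vectors. -/
noncomputable def signStates (f : Fin 2 ⊕ ℕ+ → EuclideanSpace ℝ (Fin N)) : ℕ →
    EuclideanSpace ℝ (Fin N) × EuclideanSpace ℝ (Fin N) × EuclideanSpace ℝ (Fin N)
  | 0 => (f (Sum.inl 0), f (Sum.inr 1), f (Sum.inl 1))
  -- `(n + 1).succPNat` is the index `n + 2`: `φ 1` is the reference, and state `n` holds the
  -- running estimate number `n + 1`.
  | n + 1 => ((signStates f n).1, (signStates f n).2.1, signStep (signStates f n).1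
      (signStates f n).2.1 (signStates f n).2.2 (f (Sum.inr (n + 1).succPNat)))

lemma signStates_fst (f : Fin 2 ⊕ ℕ+ → EuclideanSpace ℝ (Fin N)) (n : ℕ) :
    (signStates f n).1 = f (Sum.inl 0) := by
  induction n with
  | zero => rfl
  | succ n ih => exact ih

lemma signStates_snd_fst (f : Fin 2 ⊕ ℕ+ → EuclideanSpace ℝ (Fin N)) (n : ℕ) :
    (signStates f n).2.1 = f (Sum.inr 1) := by
  induction n with
  | zero => rfl
  | succ n ih => exact ih

lemma isOrdering_singleton {j : ℕ+} {l : List ℕ+} (h : IsOrdering {j} l) : l = [j] := by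
  obtain ⟨hnd, hl⟩ := h
  have hlen : l.length = 1 := by
    rw [← List.toFinset_card_of_nodup hnd, hl, Finset.card_singleton]
  obtain ⟨a, rfl⟩ := List.length_eq_one_iff.1 hlen
  simpa using hl

lemma runningEstimate_eq_signStates (f : Fin 2 ⊕ ℕ+ → EuclideanSpace ℝ (Fin N))
    (ord : ℕ+ → List ℕ+) (hord : ∀ k : ℕ+, 2 ≤ k → ord k = [1]) (n : ℕ) :
    runningEstimate (fun j => f (Sum.inr j))
      (fpqRepresentation (f (Sum.inl 0)) fun j => f (Sum.inr j)) ord (f (Sum.inl 1)) n.succPNat =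
      (signStates f n).2.2 := by
  induction n with
  | zero => rfl
  | succ n ih =>
    have hs : (n + 1).succPNat = n.succPNat + 1 := rfl
    have h2 : (2 : ℕ+) ≤ n.succPNat + 1 := by
      rw [← PNat.coe_le_coe]; simp
    rw [runningEstimate] at ih ⊢
    rw [hs, PNat.recOn_succ, ih, hord _ h2]
    simp only [List.foldl_cons, List.foldl_nil, signStates, signStates_fst, signStates_snd_fst,
      signStep, fpqRepresentation, hs]

variable {Ω : Type*} [mΩ : MeasurableSpace Ω] {P : Measure Ω}
  {f : Fin 2 ⊕ ℕ+ → Ω → EuclideanSpace ℝ (Fin N)}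

lemma isSignChain_signStates (hf : ∀ i, Measurable (f i)) (hind : iIndepFun f P)
    (hlaw : ∀ i, P.map (f i) = uniformSphere N) :
    IsSignChain P (frameFiltration f hf) (fun n ω => signStates (fun i => f i ω) n)
      (fun n => f (Sum.inr (n + 1).succPNat)) := by
  have hpast : ∀ n, ∀ i ∈ pastIndices n, Measurable[frameFiltration f hf n] (f i) := fun n i hi =>
    measurable_iff_comap_le.2
      (le_iSup₂ (f := fun i (_ : i ∈ pastIndices n) =>
        MeasurableSpace.comap (f i) inferInstance) i hi)
  have hnorm : ∀ i, ∀ᵐ ω ∂P, ‖f i ω‖ = 1 := fun i =>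
    ae_of_ae_map (hf i).aemeasurable (by rw [hlaw i]; exact ae_norm_eq_one_uniformSphere)
  refine ⟨?_, ?_, ?_, fun n => hlaw _, fun n ω => rfl, ?_⟩
  · refine (hpast 0 _ ?_).prodMk ((hpast 0 _ ?_).prodMk (hpast 0 _ ?_))
    · rintro k ⟨⟩
    · rintro k ⟨⟩; simp
    · rintro k ⟨⟩
  · intro n
    refine hpast _ _ ?_
    rintro k ⟨⟩
    simp
  · intro n
    have hd : Disjoint (pastIndices n) {Sum.inr (n + 1).succPNat} := by
      rw [Set.disjoint_singleton_right]
      intro hi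
      have := hi _ rfl
      simp at this
    have h := indep_iSup_of_disjoint (fun i => (hf i).comap_le) hind hd
    rw [iSup_singleton] at h
    exact h
  · filter_upwards [hnorm (Sum.inl 0), hnorm (Sum.inr 1), hnorm (Sum.inl 1)] with ω h1 h2 h3
    exact ⟨h1, h2, h3⟩

/-- Equality in Cauchy–Schwarz for unit vectors would force `p = ±x`, which has probability zero by
independence. -/
lemma ae_inner_sq_lt_one [IsProbabilityMeasure P] (hN : 2 ≤ N)
    {x p : Ω → EuclideanSpace ℝ (Fin N)} (hx : Measurable x) (hp : Measurable p)
    (hind : IndepFun x p P) (hlx : P.map x = uniformSphere N) (hlp : P.map p = uniformSphere N) :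
    ∀ᵐ ω ∂P, (inner ℝ (x ω) (p ω) : ℝ) ^ 2 < 1 := by
  have := isProbabilityMeasure_uniformSphere hN
  have hx1 : ∀ᵐ ω ∂P, ‖x ω‖ = 1 :=
    ae_of_ae_map hx.aemeasurable (by rw [hlx]; exact ae_norm_eq_one_uniformSphere)
  have hp1 : ∀ᵐ ω ∂P, ‖p ω‖ = 1 :=
    ae_of_ae_map hp.aemeasurable (by rw [hlp]; exact ae_norm_eq_one_uniformSphere)
  have hi : Indep (MeasurableSpace.comap x inferInstance) (MeasurableSpace.comap p inferInstance) P :=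
    (IndepFun_iff_Indep _ _ _).1 hind
  have hne1 := ae_ne_of_indep hx.comap_le (comap_measurable x) hp hi hlp
    (uniformSphere_singleton hN) measurable_id
  have hne2 := ae_ne_of_indep hx.comap_le (comap_measurable x) hp hi hlp
    (uniformSphere_singleton hN) measurable_neg
  filter_upwards [hx1, hp1, hne1, hne2] with ω h1 h2 h3 h4
  rw [sq_lt_one_iff_abs_lt_one, abs_lt]
  constructor
  · have := inner_lt_one_iff_real_of_norm_eq_one (x := -x ω) (y := p ω) (by rwa [norm_neg]) h2
    rw [inner_neg_left] at this
    linarith [this.2 (Ne.symm h4)]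
  · exact (inner_lt_one_iff_real_of_norm_eq_one h1 h2).2 (Ne.symm h3)

end Reduction

theorem theorem6 (N : ℕ) (hN : 2 ≤ N)
    {Ω : Type*} [MeasurableSpace Ω] (P : Measure Ω) [IsProbabilityMeasure P]
    (x xhat₁ : Ω → EuclideanSpace ℝ (Fin N)) (φ : ℕ+ → Ω → EuclideanSpace ℝ (Fin N))
    (hlaw : ∀ i : Fin 2 ⊕ ℕ+, HasLaw (Sum.elim ![x, xhat₁] φ i) (uniformSphere N) P)
    (hindep : iIndepFun (Sum.elim ![x, xhat₁] φ) P)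
    (J : ℕ+ → Finset ℕ+) (hJ : ∀ k : ℕ+, 2 ≤ k → J k = {1})
    (ord : Ω → ℕ+ → List ℕ+) (hord : ∀ (ω : Ω) (k : ℕ+), 2 ≤ k → IsOrdering (J k) (ord ω k))
    (p : ℝ) (hp : p < 2) :
    ∀ᵐ ω ∂P, Tendsto
      (fun k : ℕ+ =>
        ‖x ω - normalizedEstimate (fun j => φ j ω)
            (fpqRepresentation (x ω) (fun j => φ j ω)) (ord ω) (xhat₁ ω) k‖ ^ 2 * (k : ℝ) ^ p)
      atTop (𝓝 0) := by
  -- `HasLaw` gives only almost everywhere measurability; the chain is built from measurable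
  -- versions.
  set f : Fin 2 ⊕ ℕ+ → Ω → EuclideanSpace ℝ (Fin N) :=
    fun i => (hlaw i).aemeasurable.mk (Sum.elim ![x, xhat₁] φ i) with hfdef
  have hf : ∀ i, Measurable (f i) := fun i => (hlaw i).aemeasurable.measurable_mk
  have hae : ∀ i, Sum.elim ![x, xhat₁] φ i =ᵐ[P] f i := fun i => (hlaw i).aemeasurable.ae_eq_mk
  have hind : iIndepFun f P := hindep.congr hae
  have hl : ∀ i, P.map (f i) = uniformSphere N := fun i => by
    rw [← Measure.map_congr (hae i), (hlaw i).map_eq]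
  have hchain := isSignChain_signStates hf hind hl
  have hxp := ae_inner_sq_lt_one hN (hf (Sum.inl 0)) (hf (Sum.inr 1))
    (hind.indepFun (by simp)) (hl _) (hl _)
  filter_upwards [hchain.ae_tendsto hN hxp hp, ae_all_iff.2 hae] with ω hω heq
  have hx : x ω = f (Sum.inl 0) ω := heq (Sum.inl 0)
  have hz : xhat₁ ω = f (Sum.inl 1) ω := heq (Sum.inl 1)
  have hφ : (fun j => φ j ω) = fun j => f (Sum.inr j) ω := funext fun j => heq (Sum.inr j)
  -- A singleton has only one ordering, so no measurability of the random order is needed.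
  have hord' : ∀ k : ℕ+, 2 ≤ k → ord ω k = [1] := fun k hk =>
    isOrdering_singleton (hJ k hk ▸ hord ω k hk)
  have hpred : Tendsto PNat.natPred atTop atTop := OrderIso.pnatIsoNat.tendsto_atTop
  refine (hω.comp hpred).congr fun k => ?_
  have hk : k = k.natPred.succPNat := (PNat.succPNat_natPred k).symm
  have hcast : (k : ℝ) = (k.natPred : ℝ) + 1 := by
    exact_mod_cast (PNat.natPred_add_one k).symm
  have hrun := runningEstimate_eq_signStates (fun i => f i ω) (ord ω) hord' k.natPred
  rw [← hk] at hrun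
  rw [normalizedEstimate, hx, hz, hφ, hrun, hcast]
  rfl
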